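/- Let $\mu(dx)=\frac{1}{2\pi}\sqrt{4-x^2}\,\chi_{[-2,2]}(x)\,dx$ be the semi-circle law and let $\Phi_0=1$, $\Phi_1=x$, $\Phi_{n+2}=x\Phi_{n+1}-\Phi_n$ be its monic orthogonal polynomials, an orthonormal basis of the complex space $L^2(\mu)$. Let $X$ be the operator of multiplication by $x$ on $L^2(\mu)$, and let $a^+,a^-,a^0$ be the bounded operators on $L^2(\mu)$ determined by $a^+\Phi_n=\Phi_{n+1}$, $a^-\Phi_{n+1}=\Phi_n$, $a^-\Phi_0=0$ and $X=a^++a^0+a^-$. Put $P_X=i(a^+-a^-)$ and $E_X=\frac12P_X^2$. For $g\in L^2(\mu)$ let $$H_\mu g(x)=2\,\mathrm{p.v.}\!\int\frac{g(y)}{x-y}\,\mu(dy)=2\lim_{\varepsilon\downarrow0}\int_{|x-y|>\varepsilon}\frac{g(y)}{x-y}\,\mu(dy).$$ Let $\rho(x)=(2\pi)^{-1/2}(4-x^2)^{1/4}\chi_{[-2,2]}(x)$, let $\rho^{-1}$ be $1/\rho$ on $\{\rho\neq0\}$ and $0$ elsewhere, and let $V:L^2(\mu)\to L^2(\mathbb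 R,dx)$ be the isometry $Vf=\rho f$. Theorem 2.2. For every $g\in L^2(\mu)$ the principal value $H_\mu g(x)$ exists for $\mu$-almost every $x$ and $H_\mu g\in L^2(\mu)$; for every $f\in L^2(\mathbb R)$ one has $\rho^{-1}f\in L^2(\mu)$. Moreover, for every $f\in L^2(\mathbb R)$ and almost every $x\in\mathbb R$: 1. $Q:=VXV^*$ is the position operator on $[-2,2]$: $(Qf)(x)=\chi_{[-2,2]}(x)\,x f(x)$ (so $Q$ is multiplication by $x$ on the range of $V$, the space of functions vanishing outside $[-2,2]$). 2. $P:=VP_XV^*=i\rho H_\mu\rho^{-1}$, that is, $(Pf)(x)=i\rho(x)\,H_\mu[\rho^{-1}f](x)$. 3. $A^{\pm}:=Va^{\pm}V^*=\frac12\left(Q\pm\rho H_\mu\rho^{-1}\right)$, that is, $(A^\pm f)(x)=\frac12\left(\chi_{[-2,2]}(x)\,xf(x)\pm\rho(x)H_\mu[\rho^{-1}f](x)\right)$, and $A^0:=Va^0V^*=0$. 4. $E:=VE_XV^*=\frac12P^2=-\frac12\rho H_\mu^2\rho^{-1}$, that is, $(Ef)(x)=-\frac12\rho(x)\,H_\mu[H_\mu[\rho^{-1}f]](x)$.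 (At points $x$ with $\rho(x)=0$ the terms carrying the factor $\rho(x)$ are read as $0$.) -/

import Mathlib

open MeasureTheory Filter Topology Set
open scoped ENNReal InnerProductSpace

namespace FreeQM

/-- The semi-circle law on `[-2, 2]`: density `√(4 - x²) / (2π)` with respect to Lebesgue measure. -/
noncomputable def semicircle : Measure ℝ :=
  (volume.restrict (Icc (-2 : ℝ) 2)).withDensity
    fun x => ENNReal.ofReal (Real.sqrt (4 - x ^ 2) / (2 * Real.pi))

/-- `ρ(x) = (2π)^{-1/2} (4 - x²)^{1/4} χ_{[-2,2]}(x)`. -/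
noncomputable def rho : ℝ → ℝ :=
  (Icc (-2 : ℝ) 2).indicator fun x => (4 - x ^ 2) ^ (1 / 4 : ℝ) / Real.sqrt (2 * Real.pi)

/-- The Hilbert space `L²([-2,2], μ)` (complex valued). -/
noncomputable abbrev L2mu : Type := Lp ℂ 2 semicircle

/-- The Hilbert space `L²(ℝ, λ)` (complex valued), `λ` the Lebesgue measure. -/
noncomputable abbrev L2R : Type := Lp ℂ 2 (volume : Measure ℝ)

theorem rho_nonneg (x : ℝ) : 0 ≤ rho x := by
  unfold rho
  apply indicator_nonneg
  intro y hy
  have : 0 ≤ 4 - y ^ 2 := by nlinarith [hy.1, hy.2]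
  positivity

theorem rho_sq (x : ℝ) :
    rho x ^ 2 = (Icc (-2 : ℝ) 2).indicator (fun x => Real.sqrt (4 - x ^ 2) / (2 * Real.pi)) x := by
  unfold rho
  by_cases hx : x ∈ Icc (-2 : ℝ) 2
  · have h0 : 0 ≤ 4 - x ^ 2 := by nlinarith [hx.1, hx.2]
    rw [indicator_of_mem hx, indicator_of_mem hx, div_pow, Real.sq_sqrt (by positivity),
      ← Real.rpow_natCast, ← Real.rpow_mul h0, Real.sqrt_eq_rpow]
    norm_num
  · simp [indicator_of_notMem hx]

theorem measurable_rho : Measurable rho := by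
  unfold rho
  exact Measurable.indicator (by fun_prop) measurableSet_Icc

theorem semicircle_eq :
    semicircle = (volume : Measure ℝ).withDensity fun x => ENNReal.ofReal (rho x ^ 2) := by
  unfold semicircle
  rw [← withDensity_indicator measurableSet_Icc]
  congr 1
  funext x
  rw [rho_sq]
  by_cases hx : x ∈ Icc (-2 : ℝ) 2
  · simp [indicator_of_mem hx]
  · simp [indicator_of_notMem hx]

theorem ae_semicircle_iff {p : ℝ → Prop} :
    (∀ᵐ x ∂semicircle, p x) ↔ ∀ᵐ x, rho x ≠ 0 → p x := by
  rw [semicircle_eq, ae_withDensity_iff (measurable_rho.pow_const 2).ennreal_ofReal]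
  refine eventually_congr (Eventually.of_forall fun x => ?_)
  have : ENNReal.ofReal (rho x ^ 2) ≠ 0 ↔ rho x ≠ 0 := by
    rw [Ne, ENNReal.ofReal_eq_zero, not_le]
    constructor
    · intro h h0
      simp [h0] at h
    · intro h
      positivity
  rw [this]

theorem ae_semicircle_mem : ∀ᵐ x ∂semicircle, x ∈ Icc (-2 : ℝ) 2 := by
  rw [ae_semicircle_iff]
  refine Eventually.of_forall fun x hx => ?_
  by_contra h
  exact hx (indicator_of_notMem h _)

theorem eLpNorm_rho_mul (f : ℝ → ℂ) (hf : Measurable f) :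
    eLpNorm (fun x => (rho x : ℂ) * f x) 2 volume = eLpNorm f 2 semicircle := by
  rw [eLpNorm_eq_lintegral_rpow_enorm_toReal (by simp) (by simp),
    eLpNorm_eq_lintegral_rpow_enorm_toReal (by simp) (by simp), semicircle_eq,
    lintegral_withDensity_eq_lintegral_mul _ (measurable_rho.pow_const 2).ennreal_ofReal
      (by fun_prop)]
  congr 1
  refine lintegral_congr fun x => ?_
  have h1 : ‖(rho x : ℂ)‖ₑ = ENNReal.ofReal (rho x) := by
    rw [← ofReal_norm, Complex.norm_real, Real.norm_of_nonneg (rho_nonneg x)]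
  simp only [Pi.mul_apply, enorm_mul, h1, ENNReal.toReal_ofNat]
  rw [ENNReal.mul_rpow_of_nonneg _ _ (by norm_num), ENNReal.ofReal_pow (rho_nonneg x)]
  norm_cast

theorem memLp_rho_mul (f : L2mu) : MemLp (fun x => (rho x : ℂ) * f x) 2 volume := by
  have hm : Measurable (f : ℝ → ℂ) := (Lp.stronglyMeasurable f).measurable
  refine ⟨?_, ?_⟩
  · have := measurable_rho
    exact Measurable.aestronglyMeasurable (by fun_prop)
  · rw [eLpNorm_rho_mul _ hm]
    exact Lp.eLpNorm_lt_top f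

/-- The isometry `V : L²(μ) → L²(ℝ)`, `V f = ρ f`. -/
noncomputable def V : L2mu →ₗᵢ[ℂ] L2R where
  toFun f := (memLp_rho_mul f).toLp _
  map_add' f g := by
    rw [← MemLp.toLp_add, MemLp.toLp_eq_toLp_iff]
    filter_upwards [ae_semicircle_iff.1 (Lp.coeFn_add f g)] with x hx
    by_cases h : rho x = 0
    · simp [h]
    · simp only [hx h, Pi.add_apply, mul_add]
  map_smul' c f := by
    rw [RingHom.id_apply, ← MemLp.toLp_const_smul, MemLp.toLp_eq_toLp_iff]
    filter_upwards [ae_semicircle_iff.1 (Lp.coeFn_smul c f)] with x hx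
    by_cases h : rho x = 0
    · simp [h]
    · simp only [hx h, Pi.smul_apply, smul_eq_mul]
      ring
  norm_map' f := by
    change ‖(memLp_rho_mul f).toLp _‖ = ‖f‖
    rw [Lp.norm_toLp, eLpNorm_rho_mul _ (Lp.stronglyMeasurable f).measurable, Lp.norm_def]

theorem V_coeFn (f : L2mu) : V f =ᵐ[volume] fun x => (rho x : ℂ) * f x :=
  MemLp.coeFn_toLp (memLp_rho_mul f)

/-- `T ↦ V T V*`, from operators on `L²(μ)` to operators on `L²(ℝ)`. -/
noncomputable def conjV (T : L2mu →L[ℂ] L2mu) : L2R →L[ℂ] L2R :=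
  V.toContinuousLinearMap ∘L T ∘L (ContinuousLinearMap.adjoint V.toContinuousLinearMap)

theorem norm_mul_le_ae (f : L2mu) : ∀ᵐ x : ℝ ∂semicircle, ‖(x : ℂ) * f x‖ ≤ 2 * ‖f x‖ := by
  filter_upwards [ae_semicircle_mem] with x hx
  rw [norm_mul, Complex.norm_real]
  gcongr
  exact abs_le.2 ⟨hx.1, hx.2⟩

theorem memLp_mul (f : L2mu) : MemLp (fun x : ℝ => (x : ℂ) * f x) 2 semicircle := by
  refine (Lp.memLp f).of_le_mul (c := 2) ?_ (norm_mul_le_ae f)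
  have hm : Measurable (f : ℝ → ℂ) := (Lp.stronglyMeasurable f).measurable
  exact Measurable.aestronglyMeasurable (by fun_prop)

/-- The free position operator `X`: multiplication by the coordinate on `L²(μ)`. -/
noncomputable def positionX : L2mu →L[ℂ] L2mu :=
  LinearMap.mkContinuous
    { toFun := fun f => (memLp_mul f).toLp _
      map_add' := fun f g => by
        rw [← MemLp.toLp_add, MemLp.toLp_eq_toLp_iff]
        filter_upwards [Lp.coeFn_add f g] with x hx
        simp only [hx, Pi.add_apply, mul_add]
      map_smul' := fun c f => by
        rw [RingHom.id_apply, ← MemLp.toLp_const_smul, MemLp.toLp_eq_toLp_iff]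
        filter_upwards [Lp.coeFn_smul c f] with x hx
        simp only [hx, Pi.smul_apply, smul_eq_mul]
        ring }
    2 (fun f => by
      refine Lp.norm_le_mul_norm_of_ae_le_mul ?_
      filter_upwards [norm_mul_le_ae f, MemLp.coeFn_toLp (memLp_mul f)] with x hx h2
      simpa [h2] using hx)

theorem positionX_coeFn (f : L2mu) :
    positionX f =ᵐ[semicircle] fun x : ℝ => (x : ℂ) * f x :=
  MemLp.coeFn_toLp (memLp_mul f)

/-! ### The orthogonal polynomials and the creation, annihilation, preservation operators -/

instance : IsFiniteMeasure semicircle := by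
  unfold semicircle
  refine isFiniteMeasure_withDensity_ofReal ?_
  exact (ContinuousOn.integrableOn_compact isCompact_Icc (by fun_prop)).2

theorem memLp_of_continuous {f : ℝ → ℂ} (hf : Continuous f) : MemLp f 2 semicircle := by
  obtain ⟨C, hC⟩ := isCompact_Icc.exists_bound_of_continuousOn
    (s := Icc (-2 : ℝ) 2) hf.continuousOn
  exact MemLp.of_bound hf.aestronglyMeasurable C
    (ae_semicircle_mem.mono fun x hx => hC x hx)

/-- The (monic) polynomial `Φ_n`, given by `Φ_0 = 1`, `Φ_1 = x`, `Φ_{n+2} = x Φ_{n+1} - Φ_n`, so that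
`Φ_n(2 cos θ) sin θ = sin ((n + 1) θ)`. -/
noncomputable def phiPoly (n : ℕ) : Polynomial ℝ := Polynomial.Chebyshev.S ℝ n

theorem memLp_phi (n : ℕ) :
    MemLp (fun x => (((phiPoly n).eval x : ℝ) : ℂ)) 2 semicircle :=
  memLp_of_continuous (by fun_prop)

/-- `Φ_n` as a vector of `L²(μ)`. -/
noncomputable def phiVec (n : ℕ) : L2mu := (memLp_phi n).toLp _

theorem integral_semicircle (f : ℝ → ℝ) :
    ∫ x, f x ∂semicircle = ∫ x in (-2 : ℝ)..2, f x * (Real.sqrt (4 - x ^ 2) / (2 * Real.pi)) := by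
  unfold semicircle
  rw [integral_withDensity_eq_integral_toReal_smul (by fun_prop) (by simp),
    intervalIntegral.integral_of_le (by norm_num), integral_Icc_eq_integral_Ioc]
  refine integral_congr_ae (Eventually.of_forall fun x => ?_)
  simp only [smul_eq_mul]
  rw [ENNReal.toReal_ofReal (by positivity), mul_comm]

theorem integral_phi_mul_phi (n m : ℕ) :
    ∫ x, (phiPoly n).eval x * (phiPoly m).eval x ∂semicircle = if n = m then 1 else 0 := by
  have hpi := Real.pi_pos
  have h1 : ∫ x, (phiPoly n).eval x * (phiPoly m).eval x ∂semicircle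
      = (2 / Real.pi) * ∫ u, (phiPoly n).eval (2 * u) * (phiPoly m).eval (2 * u) * (1 - u ^ 2)
          ∂Polynomial.Chebyshev.measureT := by
    rw [integral_semicircle, Polynomial.Chebyshev.integral_measureT,
      ← intervalIntegral.integral_const_mul]
    have := intervalIntegral.smul_integral_comp_mul_left (a := -1) (b := 1)
      (fun x => (phiPoly n).eval x * (phiPoly m).eval x
        * (Real.sqrt (4 - x ^ 2) / (2 * Real.pi))) 2
    norm_num at this
    rw [← this, ← intervalIntegral.integral_const_mul]
    refine intervalIntegral.integral_congr fun u hu => ?_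
    rw [uIcc_of_le (by norm_num)] at hu
    have h0 : 0 ≤ 1 - u ^ 2 := by nlinarith [hu.1, hu.2]
    have h4 : Real.sqrt (4 - (2 * u) ^ 2) = 2 * Real.sqrt (1 - u ^ 2) := by
      rw [show 4 - (2 * u) ^ 2 = 2 ^ 2 * (1 - u ^ 2) by ring, Real.sqrt_mul (by norm_num),
        Real.sqrt_sq (by norm_num)]
    have h5 : (1 - u ^ 2) * Real.sqrt (1 - u ^ 2)⁻¹ = Real.sqrt (1 - u ^ 2) := by
      rcases h0.eq_or_lt with h | h
      · simp [← h]
      · rw [Real.sqrt_inv, ← div_eq_mul_inv, Real.div_sqrt]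
    simp only [h4]
    rw [mul_assoc (_ * _) (1 - u ^ 2), h5]
    field_simp
    try ring
  have h2 : ∫ u, (phiPoly n).eval (2 * u) * (phiPoly m).eval (2 * u) * (1 - u ^ 2)
          ∂Polynomial.Chebyshev.measureT
      = ((∫ u, (Polynomial.Chebyshev.T ℝ ((n : ℤ) - m)).eval u ∂Polynomial.Chebyshev.measureT)
        - ∫ u, (Polynomial.Chebyshev.T ℝ ((n : ℤ) + m + 2)).eval u
            ∂Polynomial.Chebyshev.measureT) / 2 := by
    rw [← integral_sub (Polynomial.Chebyshev.integrable_measureT (by fun_prop))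
        (Polynomial.Chebyshev.integrable_measureT (by fun_prop)), ← integral_div,
      Polynomial.Chebyshev.integral_measureT_eq_integral_cos,
      Polynomial.Chebyshev.integral_measureT_eq_integral_cos]
    refine intervalIntegral.integral_congr fun θ _ => ?_
    simp only [Polynomial.Chebyshev.T_real_cos, phiPoly]
    have hn := Polynomial.Chebyshev.S_two_mul_real_cos θ (n : ℤ)
    have hm := Polynomial.Chebyshev.S_two_mul_real_cos θ (m : ℤ)
    have hs : 1 - Real.cos θ ^ 2 = Real.sin θ * Real.sin θ := by
      rw [← Real.sin_sq, sq]
    rw [hs, mul_mul_mul_comm, hn, hm, Int.cast_natCast, Int.cast_natCast]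
    push_cast
    rw [show ((n : ℝ) - m) * θ = (n + 1) * θ - (m + 1) * θ by ring,
      show ((n : ℝ) + m + 2) * θ = (n + 1) * θ + (m + 1) * θ by ring, Real.cos_sub, Real.cos_add]
    ring
  rw [h1, h2, Polynomial.Chebyshev.integral_eval_T_real_measureT_of_ne_zero
    (n := (n : ℤ) + m + 2) (by positivity)]
  split_ifs with h
  · subst h
    rw [sub_self, Polynomial.Chebyshev.integral_eval_T_real_measureT_zero]
    field_simp
    try norm_num
  · rw [Polynomial.Chebyshev.integral_eval_T_real_measureT_of_ne_zero
      (n := (n : ℤ) - m) (by omega)]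
    simp

theorem orthonormal_phiVec : Orthonormal ℂ phiVec := by
  rw [orthonormal_iff_ite]
  intro n m
  have : ⟪phiVec n, phiVec m⟫_ℂ
      = ∫ x, (((phiPoly n).eval x * (phiPoly m).eval x : ℝ) : ℂ) ∂semicircle := by
    rw [L2.inner_def]
    refine integral_congr_ae ?_
    filter_upwards [MemLp.coeFn_toLp (memLp_phi n), MemLp.coeFn_toLp (memLp_phi m)] with x h1 h2
    have h1' : phiVec n x = (((phiPoly n).eval x : ℝ) : ℂ) := h1
    have h2' : phiVec m x = (((phiPoly m).eval x : ℝ) : ℂ) := h2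
    rw [h1', h2', RCLike.inner_apply, Complex.conj_ofReal]
    push_cast
    ring
  rw [this, integral_complex_ofReal, integral_phi_mul_phi]
  split_ifs <;> simp

/-- Polynomial functions as vectors of `L²(μ)`. -/
noncomputable def polyVec (p : Polynomial ℂ) : L2mu :=
  (memLp_of_continuous (f := fun x : ℝ => p.eval (x : ℂ)) (by fun_prop)).toLp _

theorem phiVec_eq (n : ℕ) : phiVec n = polyVec (Polynomial.Chebyshev.S ℂ n) := by
  unfold phiVec polyVec phiPoly
  congr 1
  funext x
  have := Polynomial.Chebyshev.complex_ofReal_eval_S x (n : ℤ)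
  exact this

theorem polyVec_mem_span (p : Polynomial ℂ) :
    polyVec p ∈ Submodule.span ℂ (range phiVec) := by
  have hadd : ∀ p q : Polynomial ℂ, polyVec (p + q) = polyVec p + polyVec q := by
    intro p q
    unfold polyVec
    rw [← MemLp.toLp_add]
    congr 1
    funext x
    simp
  have hsmul : ∀ (c : ℂ) (p : Polynomial ℂ), polyVec (c • p) = c • polyVec p := by
    intro c p
    unfold polyVec
    rw [← MemLp.toLp_const_smul]
    congr 1
    funext x
    simp
  let L : Polynomial ℂ →ₗ[ℂ] L2mu := ⟨⟨polyVec, hadd⟩, hsmul⟩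
  have key : ∀ n : ℕ, ∀ m : ℕ,
      L (Polynomial.X ^ n * Polynomial.Chebyshev.S ℂ m) ∈ Submodule.span ℂ (range phiVec) := by
    intro n
    induction n with
    | zero =>
      intro m
      rw [pow_zero, one_mul]
      exact Submodule.subset_span ⟨m, phiVec_eq m⟩
    | succ n ih =>
      intro m
      have hx : (Polynomial.X : Polynomial ℂ) * Polynomial.Chebyshev.S ℂ (m : ℤ)
          = Polynomial.Chebyshev.S ℂ ((m : ℤ) + 1) + Polynomial.Chebyshev.S ℂ ((m : ℤ) - 1) := by
        rw [Polynomial.Chebyshev.S_add_one]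
        ring
      rw [pow_succ, mul_assoc, hx, mul_add, map_add]
      refine Submodule.add_mem _ (by simpa using ih (m + 1)) ?_
      cases m with
      | zero => simp
      | succ k => simpa using ih k
  have hp : p = p.sum fun n a => a • (Polynomial.X ^ n * Polynomial.Chebyshev.S ℂ ((0 : ℕ) : ℤ)) := by
    conv_lhs => rw [p.as_sum_support_C_mul_X_pow]
    simp [Polynomial.sum, Polynomial.smul_eq_C_mul]
  change L p ∈ _
  rw [hp, Polynomial.sum, map_sum]
  refine Submodule.sum_mem _ fun n _ => ?_
  rw [map_smul]
  exact Submodule.smul_mem _ _ (key n 0)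

theorem dense_phiVec : ⊤ ≤ (Submodule.span ℂ (range phiVec)).topologicalClosure := by
  have hd := BoundedContinuousFunction.toLp_denseRange ℂ (p := 2) (μ := semicircle) ℂ (by simp)
  intro f _
  refine closure_minimal ?_ (Submodule.isClosed_topologicalClosure _) (hd f)
  rintro _ ⟨g, rfl⟩
  rw [SetLike.mem_coe, ← SetLike.mem_coe, Submodule.topologicalClosure_coe, Metric.mem_closure_iff]
  intro ε hε
  set K : ℝ := (measureUnivNNReal semicircle : ℝ) ^ ((2 : ℝ≥0∞).toReal)⁻¹ with hK
  have hK0 : 0 ≤ K := by positivity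
  set δ : ℝ := ε / (2 * (2 * K + 1)) with hδ
  have hδ0 : 0 < δ := by positivity
  obtain ⟨p, hp⟩ := exists_polynomial_near_of_continuousOn (-2) 2 (fun x => (g x).re)
    (by fun_prop) δ hδ0
  obtain ⟨q, hq⟩ := exists_polynomial_near_of_continuousOn (-2) 2 (fun x => (g x).im)
    (by fun_prop) δ hδ0
  let P : Polynomial ℂ := p.map (algebraMap ℝ ℂ) + Polynomial.C Complex.I * q.map (algebraMap ℝ ℂ)
  have hP : ∀ x : ℝ, P.eval (x : ℂ) = (p.eval x : ℝ) + Complex.I * (q.eval x : ℝ) := by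
    intro x
    simp only [P, Polynomial.eval_add, Polynomial.eval_mul, Polynomial.eval_C]
    congr 1
    · exact Polynomial.eval_map_apply (f := algebraMap ℝ ℂ) (p := p) x
    · congr 1
      exact Polynomial.eval_map_apply (f := algebraMap ℝ ℂ) (p := q) x
  refine ⟨polyVec P, polyVec_mem_span P, ?_⟩
  rw [dist_eq_norm]
  have hb : ‖BoundedContinuousFunction.toLp 2 semicircle ℂ g - polyVec P‖ ≤ K * (2 * δ) := by
    refine Lp.norm_le_of_ae_bound (by positivity) ?_
    filter_upwards [Lp.coeFn_sub (BoundedContinuousFunction.toLp 2 semicircle ℂ g) (polyVec P),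
      BoundedContinuousFunction.coeFn_toLp (p := 2) semicircle ℂ g,
      MemLp.coeFn_toLp (memLp_of_continuous (f := fun x : ℝ => P.eval (x : ℂ)) (by fun_prop)),
      ae_semicircle_mem] with x h1 h2 h3 h4
    have h3' : polyVec P x = P.eval (x : ℂ) := h3
    rw [h1, Pi.sub_apply, h2, h3', hP]
    refine (Complex.norm_le_abs_re_add_abs_im _).trans ?_
    have e1 := hp x h4
    have e2 := hq x h4
    rw [abs_sub_comm] at e1 e2
    simp only [Complex.sub_re, Complex.add_re, Complex.mul_re, Complex.ofReal_re, Complex.I_re,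
      Complex.I_im, Complex.ofReal_im, Complex.sub_im, Complex.add_im, Complex.mul_im]
    simp only [zero_mul, mul_zero, one_mul, sub_zero, add_zero, zero_add]
    linarith
  refine hb.trans_lt ?_
  rw [hδ, ← sub_pos]
  have : ε - K * (2 * (ε / (2 * (2 * K + 1)))) = ε * (K + 1) / (2 * K + 1) := by
    field_simp
    ring
  rw [this]
  positivity

/-- The orthonormal basis `(Φ_n)` of `L²(μ)`. -/
noncomputable def phiBasis : HilbertBasis ℕ ℂ L2mu :=
  HilbertBasis.mk orthonormal_phiVec dense_phiVec

/-- The creation operator: the bounded operator with `a⁺ Φ_n = Φ_{n+1}`. -/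
noncomputable def creation : L2mu →L[ℂ] L2mu :=
  ((orthonormal_phiVec.comp Nat.succ
      Nat.succ_injective).orthogonalFamily.linearIsometry).toContinuousLinearMap ∘L
    (phiBasis.repr.toLinearIsometry).toContinuousLinearMap

/-- The annihilation operator `a⁻ = (a⁺)*`: `a⁻ Φ_0 = 0`, `a⁻ Φ_{n+1} = Φ_n`. -/
noncomputable def annihilation : L2mu →L[ℂ] L2mu :=
  ContinuousLinearMap.adjoint creation

theorem phiBasis_apply (n : ℕ) : phiBasis n = phiVec n := by
  unfold phiBasis
  rw [HilbertBasis.coe_mk]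

theorem creation_phiVec (n : ℕ) : creation (phiVec n) = phiVec (n + 1) := by
  have h : phiBasis.repr (phiVec n) = lp.single 2 n (1 : ℂ) := by
    rw [← phiBasis_apply, HilbertBasis.repr_self]
  change (orthonormal_phiVec.comp Nat.succ
      Nat.succ_injective).orthogonalFamily.linearIsometry (phiBasis.repr (phiVec n)) = _
  rw [h, OrthogonalFamily.linearIsometry_apply_single]
  simp

theorem annihilation_phiVec_zero : annihilation (phiVec 0) = 0 := by
  apply phiBasis.repr.injective
  ext n
  rw [phiBasis.repr_apply_apply, phiBasis_apply, annihilation,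
    ContinuousLinearMap.adjoint_inner_right, creation_phiVec,
    orthonormal_iff_ite.1 orthonormal_phiVec]
  simp

theorem annihilation_phiVec_succ (n : ℕ) : annihilation (phiVec (n + 1)) = phiVec n := by
  apply phiBasis.repr.injective
  ext m
  rw [phiBasis.repr_apply_apply, phiBasis.repr_apply_apply, phiBasis_apply, annihilation,
    ContinuousLinearMap.adjoint_inner_right, creation_phiVec,
    orthonormal_iff_ite.1 orthonormal_phiVec, orthonormal_iff_ite.1 orthonormal_phiVec]
  simp

/-- The preservation operator `a⁰`, the remaining term in the quantum decomposition
`X = a⁺ + a⁰ + a⁻`. -/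
noncomputable def preservation : L2mu →L[ℂ] L2mu := positionX - creation - annihilation

/-- The free momentum operator `P_X = i (a⁺ - a⁻)`. -/
noncomputable def momentumX : L2mu →L[ℂ] L2mu := Complex.I • (creation - annihilation)

/-- The free kinetic energy operator `E_X = P_X² / 2`. -/
noncomputable def kineticX : L2mu →L[ℂ] L2mu := (1 / 2 : ℂ) • (momentumX ∘L momentumX)

/-! ### The `μ`-Hilbert transform -/

/-- The truncated integral `2 ∫_{|x - y| > ε} f(y) / (x - y) μ(dy)`. -/
noncomputable def truncHilbert (f : ℝ → ℂ) (x ε : ℝ) : ℂ :=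
  2 * ∫ y in {y | ε < |x - y|}, f y / ((x - y : ℝ) : ℂ) ∂semicircle

/-- The Cauchy principal value `2 p.v. ∫ f(y) / (x - y) μ(dy)` exists and equals `l`. -/
def HasHilbertAt (f : ℝ → ℂ) (x : ℝ) (l : ℂ) : Prop :=
  Tendsto (truncHilbert f x) (𝓝[>] 0) (𝓝 l)

/-- The `μ`-Hilbert transform `H_μ f (x) = 2 p.v. ∫ f(y) / (x - y) μ(dy)` (meaningful at the points
where the principal value exists, see `HasHilbertAt`). -/
noncomputable def hilbertMu (f : ℝ → ℂ) (x : ℝ) : ℂ := limUnder (𝓝[>] 0) (truncHilbert f x)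

/-- The multiplication `ρ⁻¹ f`, where `ρ⁻¹ = 1 / ρ` on the support of `ρ` and `0` elsewhere. -/
noncomputable def rhoInvMul (f : ℝ → ℂ) : ℝ → ℂ := fun x => ((rho x)⁻¹ : ℝ) * f x

end FreeQM

open FreeQM

/-! The heart of the matter is that `H_μ g = K g` almost everywhere, where `K = a⁺ - a⁻`. Write
`C_g(z) = ∫ g(y) / (z - y) μ(dy)` and `G = C_{Φ_0}`. The recurrence for `Φ_n` gives `G + 1/G = z`
and `C_{Φ_n} = G^(n+1)`, so multiplication by `z - 2G = 1/G - G` lowers and raises the index: `(z -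
2G) C_g = ⟪Φ_0, g⟫ - C_{K g}` on the basis, hence on `L²(μ)` by continuity
(`cauchy_creation_sub_annihilation`).

At `z = x ± iε` one has `C_g = Q_g ∓ i P_g`, with `P` and `Q` the Poisson and conjugate Poisson
integrals. Subtracting the identities at the two points gives `(ε + 2 P_0) Q_g = P_{K g} + (x - 2
Q_0) P_g`, where the index `0` stands for `Φ_0`. As `ε → 0`, at almost every `x` with `ρ(x) ≠ 0`,
`P_g → π ρ² g` by Lebesgue differentiation and `x - 2 Q_0 → 0` by the quadratic equation for `G`.
Hence `Q_g → K g / 2`. The truncated integral differs from `2 Q_g` by the integral of an odd kernel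
dominated by the Poisson kernel, which tends to `0` at Lebesgue points. So `ae_hasHilbertAt` yields
existence of the principal value and its membership in `L²(μ)` together, without any prior bound for
the Hilbert transform.

The formulas then follow by algebra from `X = a⁺ + a⁻`, `V* f = ρ⁻¹ f` and `V* V = 1`. -/

namespace FreeQM

/-! ### Poisson kernels and Lebesgue points -/

/-- The (unnormalised) Poisson kernel of the upper half-plane. -/
noncomputable def poissonKer (ε t : ℝ) : ℝ := ε / (t ^ 2 + ε ^ 2)

/-- The (unnormalised) conjugate Poisson kernel of the upper half-plane. -/
noncomputable def conjPoissonKer (ε t : ℝ) : ℝ := t / (t ^ 2 + ε ^ 2)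

/-- The kernel of the truncated Hilbert transform. -/
noncomputable def truncKer (ε t : ℝ) : ℝ := {t : ℝ | ε < |t|}.indicator (fun t => t⁻¹) t

theorem measurable_poissonKer (ε : ℝ) : Measurable (poissonKer ε) := by
  unfold poissonKer; fun_prop

theorem measurable_conjPoissonKer (ε : ℝ) : Measurable (conjPoissonKer ε) := by
  unfold conjPoissonKer; fun_prop

theorem measurable_truncKer (ε : ℝ) : Measurable (truncKer ε) :=
  measurable_inv.indicator (measurableSet_lt measurable_const (by fun_prop))

theorem poissonKer_nonneg {ε : ℝ} (hε : 0 < ε) (t : ℝ) : 0 ≤ poissonKer ε t := by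
  unfold poissonKer; positivity

theorem poissonKer_le {ε : ℝ} (hε : 0 < ε) (t : ℝ) : poissonKer ε t ≤ ε⁻¹ := by
  unfold poissonKer
  rw [div_le_iff₀ (by positivity), ← sub_nonneg]
  have : ε⁻¹ * (t ^ 2 + ε ^ 2) - ε = ε⁻¹ * t ^ 2 := by field_simp; ring
  rw [this]; positivity

theorem abs_conjPoissonKer_le {ε : ℝ} (hε : 0 < ε) (t : ℝ) : |conjPoissonKer ε t| ≤ ε⁻¹ := by
  unfold conjPoissonKer
  rw [abs_div, abs_of_pos (show 0 < t ^ 2 + ε ^ 2 by positivity), div_le_iff₀ (by positivity)]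
  have : ε⁻¹ * (t ^ 2 + ε ^ 2) = |t| + ε⁻¹ * ((|t| - ε) ^ 2 + |t| * ε) := by
    rw [← sq_abs t]; field_simp; ring
  rw [this]
  have := abs_nonneg t
  have : 0 ≤ ε⁻¹ * ((|t| - ε) ^ 2 + |t| * ε) := by positivity
  linarith

/-- For `|t| > ε` the difference is `ε² / (t (t² + ε²))`; otherwise only `-t / (t² + ε²)` is left,
with `|t| ≤ ε`. -/
theorem abs_truncKer_sub_conjPoissonKer_le {ε : ℝ} (hε : 0 < ε) (t : ℝ) :
    |truncKer ε t - conjPoissonKer ε t| ≤ poissonKer ε t := by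
  unfold truncKer conjPoissonKer poissonKer
  by_cases h : ε < |t|
  · rw [indicator_of_mem (by exact h)]
    have ht : t ≠ 0 := by
      rintro rfl
      simp at h
      linarith
    have : t⁻¹ - t / (t ^ 2 + ε ^ 2) = ε ^ 2 / (t * (t ^ 2 + ε ^ 2)) := by
      field_simp; ring
    rw [this, abs_div, abs_mul, abs_of_pos (show 0 < t ^ 2 + ε ^ 2 by positivity),
      abs_of_pos (show 0 < ε ^ 2 by positivity), ← div_div]
    gcongr
    rw [div_le_iff₀ (by positivity)]
    nlinarith
  · rw [indicator_of_notMem (by exact h), zero_sub, abs_neg, abs_div,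
      abs_of_pos (show 0 < t ^ 2 + ε ^ 2 by positivity)]
    gcongr
    exact not_lt.1 h

theorem poissonKer_eq {ε : ℝ} (hε : 0 < ε) (t : ℝ) :
    poissonKer ε t = ε⁻¹ * (1 + (t / ε) ^ 2)⁻¹ := by
  unfold poissonKer
  field_simp
  ring

theorem integrable_poissonKer {ε : ℝ} (hε : 0 < ε) : Integrable (poissonKer ε) := by
  have := (integrable_inv_one_add_sq.comp_div hε.ne').const_mul ε⁻¹
  exact this.congr (Eventually.of_forall fun t => (poissonKer_eq hε t).symm)

theorem integral_poissonKer {ε : ℝ} (hε : 0 < ε) : ∫ t, poissonKer ε t = Real.pi := by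
  simp_rw [poissonKer_eq hε]
  rw [integral_const_mul, Measure.integral_comp_div (fun t => (1 + t ^ 2)⁻¹),
    integral_univ_inv_one_add_sq, smul_eq_mul, abs_of_pos hε]
  field_simp

theorem lintegral_poissonKer {ε : ℝ} (hε : 0 < ε) :
    ∫⁻ t, ENNReal.ofReal (poissonKer ε t) = ENNReal.ofReal Real.pi := by
  rw [← integral_poissonKer hε, ofReal_integral_eq_lintegral_ofReal (integrable_poissonKer hε)
    (Eventually.of_forall (poissonKer_nonneg hε))]

/-! ### Layer-cake formula and Poisson means at Lebesgue points. -/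

/-- Minus the radial derivative of the Poisson kernel. -/
noncomputable def poissonSlope (ε r : ℝ) : ℝ := 2 * ε * r / (r ^ 2 + ε ^ 2) ^ 2

theorem measurable_poissonSlope (ε : ℝ) : Measurable (poissonSlope ε) := by
  unfold poissonSlope; fun_prop

theorem lintegral_Ioi_poissonSlope {ε a : ℝ} (hε : 0 < ε) (ha : 0 ≤ a) :
    ∫⁻ r in Ioi a, ENNReal.ofReal (poissonSlope ε r) = ENNReal.ofReal (poissonKer ε a) := by
  have hd : ∀ r ∈ Ici a, HasDerivAt (fun r => -poissonKer ε r) (poissonSlope ε r) r := by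
    intro r _
    have h1 : HasDerivAt (fun r : ℝ => r ^ 2 + ε ^ 2) (2 * r) r := by
      simpa using (hasDerivAt_pow 2 r).add_const (ε ^ 2)
    have := ((hasDerivAt_const r ε).div h1 (by positivity)).neg
    refine this.congr_deriv ?_
    unfold poissonSlope
    rw [← neg_div]
    congr 1
    ring
  have hn : ∀ r ∈ Ioi a, 0 ≤ poissonSlope ε r := by
    intro r hr
    have : 0 ≤ r := ha.trans (le_of_lt hr)
    unfold poissonSlope; positivity
  have ht : Tendsto (fun r => -poissonKer ε r) atTop (𝓝 0) := by
    rw [← neg_zero]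
    refine Tendsto.neg ?_
    unfold poissonKer
    refine Tendsto.const_div_atTop ?_ _
    exact tendsto_atTop_add_const_right _ _ (tendsto_pow_atTop (by norm_num))
  rw [← ofReal_integral_eq_lintegral_ofReal (integrableOn_Ioi_deriv_of_nonneg' hd hn ht)
    ((ae_restrict_iff' measurableSet_Ioi).2 (Eventually.of_forall hn)),
    integral_Ioi_of_hasDerivAt_of_nonneg' hd hn ht]
  simp

/-- The Poisson kernel as a superposition of indicator functions of balls. -/
theorem lintegral_poissonKer_mul_eq {ε : ℝ} (hε : 0 < ε) (x : ℝ) {g : ℝ → ℝ≥0∞}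
    (hg : Measurable g) :
    ∫⁻ y, ENNReal.ofReal (poissonKer ε (x - y)) * g y
      = ∫⁻ r in Ioi 0, ENNReal.ofReal (poissonSlope ε r) * ∫⁻ y in Metric.ball x r, g y := by
  have hs : MeasurableSet {p : ℝ × ℝ | |x - p.1| < p.2} :=
    measurableSet_lt (by fun_prop) (by fun_prop)
  have hk := measurable_poissonSlope ε
  have hm : Measurable (Function.uncurry fun y r : ℝ =>
      {p : ℝ × ℝ | |x - p.1| < p.2}.indicator
        (fun p => ENNReal.ofReal (poissonSlope ε p.2) * g p.1) (y, r)) := by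
    refine Measurable.indicator ?_ hs
    fun_prop
  -- The kernel at `|x - y|` is the integral of its slope over `r > |x - y|`; Tonelli then exchanges
  -- `y` and `r`.
  calc ∫⁻ y, ENNReal.ofReal (poissonKer ε (x - y)) * g y
      = ∫⁻ y, ∫⁻ r in Ioi 0, {p : ℝ × ℝ | |x - p.1| < p.2}.indicator
        (fun p => ENNReal.ofReal (poissonSlope ε p.2) * g p.1) (y, r) := by
        refine lintegral_congr fun y => ?_
        have h1 : poissonKer ε (x - y) = poissonKer ε |x - y| := by
          unfold poissonKer; rw [sq_abs]
        rw [h1, ← lintegral_Ioi_poissonSlope hε (abs_nonneg _),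
          ← lintegral_mul_const _ (by fun_prop), ← lintegral_indicator measurableSet_Ioi,
          ← lintegral_indicator measurableSet_Ioi]
        refine lintegral_congr fun r => ?_
        by_cases h : |x - y| < r
        · have h0 : 0 < r := (abs_nonneg _).trans_lt h
          rw [indicator_of_mem (by exact h), indicator_of_mem (by exact h0),
            indicator_of_mem (by exact h)]
        · rw [indicator_of_notMem (by exact h)]
          by_cases h0 : 0 < r
          · rw [indicator_of_mem (by exact h0), indicator_of_notMem (by exact h)]
          · rw [indicator_of_notMem (by exact h0)]
    _ = ∫⁻ r in Ioi 0, ∫⁻ y, {p : ℝ × ℝ | |x - p.1| < p.2}.indicator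
        (fun p => ENNReal.ofReal (poissonSlope ε p.2) * g p.1) (y, r) :=
        lintegral_lintegral_swap hm.aemeasurable
    _ = _ := by
        refine lintegral_congr fun r => ?_
        rw [← lintegral_const_mul _ hg, ← lintegral_indicator Metric.isOpen_ball.measurableSet]
        refine lintegral_congr fun y => ?_
        have : y ∈ Metric.ball x r ↔ |x - y| < r := by
          rw [Metric.mem_ball, Real.dist_eq, abs_sub_comm]
        by_cases h : |x - y| < r
        · rw [indicator_of_mem (by exact h), indicator_of_mem (this.2 h)]
        · rw [indicator_of_notMem (by exact h), indicator_of_notMem (fun h' => h (this.1 h'))]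

/-- The left side is the right side times `r² / (r² + ε²)`. This turns a bound `c * r` on ball
integrals into a multiple of the kernel itself. -/
theorem poissonSlope_mul_le {ε r : ℝ} (hε : 0 < ε) :
    poissonSlope ε r * r ≤ 2 * poissonKer ε r := by
  unfold poissonSlope poissonKer
  rw [← mul_div_assoc, div_mul_eq_mul_div, div_le_div_iff₀ (by positivity) (by positivity),
    ← sub_nonneg]
  have : 2 * ε * (r ^ 2 + ε ^ 2) ^ 2 - 2 * ε * r * r * (r ^ 2 + ε ^ 2)
    = 2 * ε ^ 3 * (r ^ 2 + ε ^ 2) := by ring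
  rw [this]
  positivity

/-- If the mean values of `g` over the balls about `x` are bounded, and small for small radius,
then so are the Poisson means of `g`. -/
theorem tendsto_lintegral_poissonKer_mul {x C : ℝ} {g : ℝ → ℝ≥0∞} (hg : Measurable g)
    (hC0 : 0 ≤ C)
    (hC : ∀ r > 0, ∫⁻ y in Metric.ball x r, g y ≤ ENNReal.ofReal (C * r))
    (h0 : ∀ η > 0, ∀ᶠ r in 𝓝[>] (0 : ℝ),
      ∫⁻ y in Metric.ball x r, g y ≤ ENNReal.ofReal (η * r)) :
    Tendsto (fun ε => ∫⁻ y, ENNReal.ofReal (poissonKer ε (x - y)) * g y) (𝓝[>] 0) (𝓝 0) := by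
  rw [ENNReal.tendsto_nhds_zero]
  intro η' hη'
  -- The radii below `δ` will contribute at most `2πη`, the remaining ones at most `η`.
  obtain ⟨η, hη, hηη'⟩ : ∃ η : ℝ, 0 < η ∧ ENNReal.ofReal (η * (2 * Real.pi + 1)) ≤ η' := by
    rcases eq_or_ne η' ⊤ with rfl | hne
    · exact ⟨1, one_pos, le_top⟩
    · have hp := Real.pi_pos
      refine ⟨η'.toReal / (2 * Real.pi + 1), ?_, ?_⟩
      · have := ENNReal.toReal_pos hη'.ne' hne
        positivity
      · rw [div_mul_cancel₀ _ (by positivity), ENNReal.ofReal_toReal hne]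
  obtain ⟨δ, hδ, hδr⟩ := mem_nhdsGT_iff_exists_Ioo_subset.1 (h0 η hη)
  have hδ' : (0 : ℝ) < δ := hδ
  -- This is the tail `2Cε ∫ r⁻² dr` over `r > δ/2`.
  have h1 : ∀ᶠ ε in 𝓝[>] (0 : ℝ), ε * (2 * C * (2 / δ)) < η := by
    have : Tendsto (fun ε : ℝ => ε * (2 * C * (2 / δ))) (𝓝[>] 0) (𝓝 (0 * (2 * C * (2 / δ)))) :=
      ((continuous_id.mul continuous_const).tendsto (0 : ℝ)).mono_left nhdsWithin_le_nhds
    rw [zero_mul] at this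
    exact this.eventually_lt_const hη
  filter_upwards [self_mem_nhdsWithin, h1] with ε hε hε2
  have hε : 0 < ε := hε
  have hk := measurable_poissonSlope ε
  have hk' := measurable_poissonKer ε
  rw [lintegral_poissonKer_mul_eq hε x hg]
  -- For `r < δ` the smallness of the means gives `2η` times the kernel; for `r ≥ δ` their
  -- boundedness and `poissonKer ε r ≤ ε r⁻²` give the tail term. Starting the tail at `δ/2` lets an
  -- open half-line contain `r = δ`.
  have hbound : ∀ r ∈ Ioi (0 : ℝ),
      ENNReal.ofReal (poissonSlope ε r) * ∫⁻ y in Metric.ball x r, g y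
        ≤ ENNReal.ofReal (2 * η) * ENNReal.ofReal (poissonKer ε r)
          + ENNReal.ofReal (2 * C / δ * ε) * (ENNReal.ofReal δ *
            (Ioi (δ / 2)).indicator (fun r => ENNReal.ofReal (r ^ (-2 : ℝ))) r) := by
    intro r hr
    have hr : 0 < r := hr
    have hs : 0 ≤ poissonSlope ε r := by unfold poissonSlope; positivity
    by_cases hrδ : r < δ
    · refine le_add_right ?_
      refine (mul_le_mul_right (hδr ⟨hr, hrδ⟩) _).trans ?_
      rw [← ENNReal.ofReal_mul hs, ← ENNReal.ofReal_mul (by positivity)]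
      refine ENNReal.ofReal_le_ofReal ?_
      have := poissonSlope_mul_le (r := r) hε
      nlinarith
    · refine le_add_left ?_
      refine (mul_le_mul_right (hC r hr) _).trans ?_
      have hr2 : δ / 2 < r := by push Not at hrδ; linarith
      rw [indicator_of_mem (by exact hr2), ← ENNReal.ofReal_mul hs,
        ← ENNReal.ofReal_mul (by positivity), ← ENNReal.ofReal_mul (by positivity)]
      refine ENNReal.ofReal_le_ofReal ?_
      have h3 := poissonSlope_mul_le (r := r) hε
      have h4 : poissonKer ε r ≤ ε * r ^ (-2 : ℝ) := by
        unfold poissonKer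
        rw [Real.rpow_neg hr.le, div_eq_mul_inv]
        norm_num
        gcongr
        nlinarith
      calc poissonSlope ε r * (C * r) = C * (poissonSlope ε r * r) := by ring
        _ ≤ C * (2 * (ε * r ^ (-2 : ℝ))) := mul_le_mul_of_nonneg_left (by linarith) hC0
        _ = _ := by field_simp
  refine (setLIntegral_mono' measurableSet_Ioi hbound).trans ?_
  refine (setLIntegral_le_lintegral _ _).trans ?_
  have hmi : Measurable ((Ioi (δ / 2)).indicator fun r : ℝ => ENNReal.ofReal (r ^ (-2 : ℝ))) :=
    Measurable.indicator (by fun_prop) measurableSet_Ioi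
  rw [lintegral_add_left (by fun_prop), lintegral_const_mul _ (by fun_prop),
    lintegral_const_mul _ (by fun_prop), lintegral_const_mul _ hmi,
    lintegral_poissonKer hε, lintegral_indicator measurableSet_Ioi,
    ← ofReal_integral_eq_lintegral_ofReal
      (integrableOn_Ioi_rpow_of_lt (by norm_num) (by positivity))
      ((ae_restrict_iff' measurableSet_Ioi).2 (Eventually.of_forall fun r hr => by
        have : 0 < r := lt_trans (by positivity) (show δ / 2 < r from hr)
        positivity)),
    integral_Ioi_rpow_of_lt (by norm_num) (by positivity),
    ← ENNReal.ofReal_mul (by positivity), ← ENNReal.ofReal_mul (by positivity),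
    ← ENNReal.ofReal_mul (by positivity), ← ENNReal.ofReal_add (by positivity)]
  · refine le_trans (ENNReal.ofReal_le_ofReal ?_) hηη'
    norm_num [Real.rpow_neg_one]
    field_simp
    field_simp at hε2
    nlinarith
  · norm_num [Real.rpow_neg_one]
    positivity

/-- At almost every point, the Poisson means of the oscillation of an integrable function vanish in
the limit. -/
theorem ae_tendsto_lintegral_poissonKer_mul_sub {φ : ℝ → ℂ} (hφ : Measurable φ)
    (hi : Integrable φ) :
    ∀ᵐ x, Tendsto (fun ε => ∫⁻ y, ENNReal.ofReal (poissonKer ε (x - y)) * ‖φ y - φ x‖ₑ)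
      (𝓝[>] 0) (𝓝 0) := by
  filter_upwards [IsUnifLocDoublingMeasure.ae_tendsto_average_norm_sub volume
    hi.locallyIntegrable 1] with x hx
  have hx := hx (l := 𝓝[>] (0 : ℝ)) (fun _ => x) id tendsto_id (by
    filter_upwards [self_mem_nhdsWithin] with r hr
    simpa using le_of_lt (show (0 : ℝ) < r from hr))
  have hint : ∀ r : ℝ, IntegrableOn (fun y => ‖φ y - φ x‖) (Metric.closedBall x r) := by
    intro r
    refine (hi.integrableOn.sub ?_).norm
    exact integrableOn_const measure_closedBall_lt_top.ne
  have h0 : ∀ η > 0, ∀ᶠ r in 𝓝[>] (0 : ℝ),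
      ∫⁻ y in Metric.ball x r, ‖φ y - φ x‖ₑ ≤ ENNReal.ofReal (η * r) := by
    intro η hη
    -- The ball has length `2r`, so a mean below `η/2` means an integral below `η r`.
    filter_upwards [hx.eventually_lt_const (show 0 < η / 2 by positivity),
      self_mem_nhdsWithin] with r hr hr0
    have hr0 : 0 < r := hr0
    calc ∫⁻ y in Metric.ball x r, ‖φ y - φ x‖ₑ
        ≤ ∫⁻ y in Metric.closedBall x r, ‖φ y - φ x‖ₑ :=
          lintegral_mono_set Metric.ball_subset_closedBall
      _ = ENNReal.ofReal (∫ y in Metric.closedBall x r, ‖φ y - φ x‖) := by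
          rw [ofReal_integral_eq_lintegral_ofReal (hint r)
            (Eventually.of_forall fun _ => norm_nonneg _)]
          simp_rw [ofReal_norm]
      _ ≤ _ := by
          refine ENNReal.ofReal_le_ofReal ?_
          rw [setAverage_eq, measureReal_def, id, Real.volume_closedBall,
            ENNReal.toReal_ofReal (by positivity), smul_eq_mul, inv_mul_lt_iff₀ (by positivity)] at hr
          linarith
  obtain ⟨δ, hδ, hδr⟩ := mem_nhdsGT_iff_exists_Ioo_subset.1 (h0 1 one_pos)
  have hδ : (0 : ℝ) < δ := hδ
  set N : ℝ := ∫ y, ‖φ y‖ with hN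
  have hN0 : 0 ≤ N := integral_nonneg fun _ => norm_nonneg _
  -- The `1` serves the radii below `δ`; for `r ≥ δ`, the total mass satisfies `N ≤ (N/δ) r`, and
  -- the constant `φ x` contributes `2r ‖φ x‖`.
  refine tendsto_lintegral_poissonKer_mul (C := 1 + N / δ + 2 * ‖φ x‖)
    (hφ.sub_const _).enorm (by positivity) ?_ h0
  intro r hr
  have hr0 : 0 < r := hr
  by_cases hrδ : r < δ
  · refine (hδr ⟨hr, hrδ⟩).trans (ENNReal.ofReal_le_ofReal ?_)
    have : 0 ≤ (N / δ + 2 * ‖φ x‖) * r := by positivity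
    nlinarith
  · push Not at hrδ
    calc ∫⁻ y in Metric.ball x r, ‖φ y - φ x‖ₑ
        ≤ ∫⁻ y in Metric.ball x r, (‖φ y‖ₑ + ‖φ x‖ₑ) := lintegral_mono fun y => enorm_sub_le
      _ = (∫⁻ y in Metric.ball x r, ‖φ y‖ₑ) + ‖φ x‖ₑ * volume (Metric.ball x r) := by
          rw [lintegral_add_left hφ.enorm, setLIntegral_const]
      _ ≤ (∫⁻ y, ‖φ y‖ₑ) + ‖φ x‖ₑ * volume (Metric.ball x r) := by
          gcongr
          exact Measure.restrict_le_self
      _ = ENNReal.ofReal (N + ‖φ x‖ * (2 * r)) := by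
          rw [ENNReal.ofReal_add hN0 (by positivity), ENNReal.ofReal_mul (by positivity),
            Real.volume_ball, hN, ofReal_integral_norm_eq_lintegral_enorm hi, ofReal_norm]
      _ ≤ _ := by
          refine ENNReal.ofReal_le_ofReal ?_
          have : N ≤ N / δ * r := by
            rw [div_mul_eq_mul_div, le_div_iff₀ hδ]
            gcongr
          nlinarith

/-- Convergence at a Lebesgue point for kernels dominated by the Poisson kernel. -/
theorem tendsto_integral_kernel {φ : ℝ → ℂ} (hi : Integrable φ) {x : ℝ}
    (hx : Tendsto (fun ε => ∫⁻ y, ENNReal.ofReal (poissonKer ε (x - y)) * ‖φ y - φ x‖ₑ)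
      (𝓝[>] 0) (𝓝 0))
    {k : ℝ → ℝ → ℝ} (hk : ∀ ε, Measurable (k ε))
    (hkp : ∀ ε > 0, ∀ t, |k ε t| ≤ poissonKer ε t) {c : ℝ} (hc : ∀ ε > 0, ∫ t, k ε t = c) :
    Tendsto (fun ε => ∫ y, (k ε (x - y) : ℂ) * φ y) (𝓝[>] 0) (𝓝 (c * φ x)) := by
  rw [tendsto_iff_edist_tendsto_0]
  refine tendsto_of_tendsto_of_tendsto_of_le_of_le' tendsto_const_nhds hx
    (Eventually.of_forall fun _ => zero_le) ?_
  filter_upwards [self_mem_nhdsWithin] with ε hε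
  have hε : 0 < ε := hε
  have hmk : Measurable fun y : ℝ => (k ε (x - y) : ℂ) := by
    have := hk ε
    fun_prop
  have hki : Integrable fun y : ℝ => (k ε (x - y) : ℂ) := by
    refine ((integrable_poissonKer hε).comp_sub_left x).mono' hmk.aestronglyMeasurable
      (Eventually.of_forall fun y => ?_)
    rw [Complex.norm_real]
    exact hkp ε hε _
  have hkφ : Integrable fun y => (k ε (x - y) : ℂ) * φ y := by
    refine hi.bdd_mul (c := ε⁻¹) hmk.aestronglyMeasurable (Eventually.of_forall fun y => ?_)
    rw [Complex.norm_real]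
    exact (hkp ε hε _).trans (poissonKer_le hε _)
  have hc' : (c : ℂ) * φ x = ∫ y, (k ε (x - y) : ℂ) * φ x := by
    rw [integral_mul_const, integral_complex_ofReal, integral_sub_left_eq_self (k ε), hc ε hε]
  rw [edist_eq_enorm_sub, hc', ← integral_sub hkφ (hki.mul_const _)]
  refine (enorm_integral_le_lintegral_enorm _).trans (lintegral_mono fun y => ?_)
  dsimp only
  rw [← mul_sub, enorm_mul]
  gcongr
  rw [← ofReal_norm, Complex.norm_real]
  exact ENNReal.ofReal_le_ofReal (hkp ε hε _)

/-- The integrand is odd, and the reflection `t ↦ -t` needs neither integrability nor a sign of `ε`.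
-/
theorem integral_truncKer_sub_conjPoissonKer (ε : ℝ) :
    ∫ t, (truncKer ε t - conjPoissonKer ε t) = 0 := by
  have h : ∀ t, truncKer ε (-t) - conjPoissonKer ε (-t)
      = -(truncKer ε t - conjPoissonKer ε t) := by
    intro t
    have h1 : truncKer ε (-t) = -truncKer ε t := by
      unfold truncKer
      by_cases h : ε < |t|
      · rw [indicator_of_mem (by simpa using h), indicator_of_mem (by simpa using h), inv_neg]
      · rw [indicator_of_notMem (by simpa using h), indicator_of_notMem (by simpa using h),
          neg_zero]
    rw [h1]
    unfold conjPoissonKer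
    rw [neg_sq]
    ring
  have := integral_neg_eq_self (fun t => truncKer ε t - conjPoissonKer ε t) volume
  simp_rw [h] at this
  rw [integral_neg] at this
  linarith

/-! ### The quantum decomposition of the position operator -/

theorem positionX_phiVec_zero : positionX (phiVec 0) = phiVec 1 := by
  refine Lp.ext ?_
  filter_upwards [positionX_coeFn (phiVec 0), MemLp.coeFn_toLp (memLp_phi 0),
    MemLp.coeFn_toLp (memLp_phi 1)] with x h1 h2 h3
  change phiVec 0 x = _ at h2
  change phiVec 1 x = _ at h3
  rw [h1, h2, h3]
  simp [phiPoly]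

theorem positionX_phiVec_succ (n : ℕ) :
    positionX (phiVec (n + 1)) = phiVec (n + 2) + phiVec n := by
  refine Lp.ext ?_
  filter_upwards [positionX_coeFn (phiVec (n + 1)), MemLp.coeFn_toLp (memLp_phi (n + 1)),
    MemLp.coeFn_toLp (memLp_phi (n + 2)), MemLp.coeFn_toLp (memLp_phi n),
    Lp.coeFn_add (phiVec (n + 2)) (phiVec n)] with x h1 h2 h3 h4 h5
  change phiVec (n + 1) x = _ at h2
  change phiVec (n + 2) x = _ at h3
  change phiVec n x = _ at h4
  rw [h1, h5, Pi.add_apply, h2, h3, h4]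
  unfold phiPoly
  push_cast
  rw [Polynomial.Chebyshev.S_add_two]
  simp

theorem dense_span_phiVec : Dense (Submodule.span ℂ (range phiVec) : Set L2mu) := by
  rw [Submodule.dense_iff_topologicalClosure_eq_top]
  exact top_le_iff.1 dense_phiVec

/-- The three-term recurrence has no diagonal term; this is what makes `a⁰` vanish. -/
theorem positionX_eq : positionX = creation + annihilation := by
  refine ContinuousLinearMap.ext_on dense_span_phiVec ?_
  rintro _ ⟨n, rfl⟩
  rw [add_apply, creation_phiVec]
  cases n with
  | zero => rw [annihilation_phiVec_zero, add_zero, positionX_phiVec_zero]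
  | succ n => rw [annihilation_phiVec_succ, positionX_phiVec_succ]

/-! ### The Cauchy transform of the semi-circle law -/

theorem ofReal_sub_ne_zero {z : ℂ} (hz : z.im ≠ 0) (y : ℝ) : z - y ≠ 0 := by
  intro h
  apply hz
  have := congrArg Complex.im h
  simpa using this

theorem continuous_inv_sub {z : ℂ} (hz : z.im ≠ 0) : Continuous fun y : ℝ => (z - y)⁻¹ :=
  (continuous_const.sub Complex.continuous_ofReal).inv₀ (ofReal_sub_ne_zero hz)

/-- The conjugate compensates the antilinear first slot of the inner product. The Cauchy transform
becomes a bounded functional, so linear identities can be checked on the `phiVec n`. -/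
theorem memLp_star_inv_sub {z : ℂ} (hz : z.im ≠ 0) :
    MemLp (fun y : ℝ => star (z - y)⁻¹) 2 semicircle :=
  memLp_of_continuous (continuous_inv_sub hz).star

/-- The Cauchy transform `g ↦ ∫ g(y) / (z - y) μ(dy)`, at a nonreal point `z`. -/
noncomputable def cauchy {z : ℂ} (hz : z.im ≠ 0) : L2mu →L[ℂ] ℂ :=
  innerSL ℂ ((memLp_star_inv_sub hz).toLp _)

theorem cauchy_apply {z : ℂ} (hz : z.im ≠ 0) (g : L2mu) :
    cauchy hz g = ∫ y : ℝ, (z - y)⁻¹ * g y ∂semicircle := by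
  unfold cauchy
  rw [innerSL_apply_apply, L2.inner_def]
  refine integral_congr_ae ?_
  filter_upwards [MemLp.coeFn_toLp (memLp_star_inv_sub hz)] with y hy
  rw [hy, RCLike.inner_apply]
  simp [mul_comm]

theorem integrable_L2mu (g : L2mu) : Integrable g semicircle :=
  (Lp.memLp g).integrable (by norm_num)

theorem integrable_inv_sub_mul {z : ℂ} (hz : z.im ≠ 0) (g : L2mu) :
    Integrable (fun y : ℝ => (z - y)⁻¹ * g y) semicircle := by
  obtain ⟨C, hC⟩ := isCompact_Icc.exists_bound_of_continuousOn
    (s := Icc (-2 : ℝ) 2) (continuous_inv_sub hz).continuousOn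
  exact (integrable_L2mu g).bdd_mul (c := C) (continuous_inv_sub hz).aestronglyMeasurable
    (ae_semicircle_mem.mono fun x hx => hC x hx)

theorem inner_phiVec_zero (g : L2mu) : ⟪phiVec 0, g⟫_ℂ = ∫ y, g y ∂semicircle := by
  rw [L2.inner_def]
  refine integral_congr_ae ?_
  filter_upwards [MemLp.coeFn_toLp (memLp_phi 0)] with y hy
  change phiVec 0 y = _ at hy
  rw [hy, RCLike.inner_apply]
  simp [phiPoly]

/-- Integrate `y / (z - y) = z / (z - y) - 1` against `g μ`. -/
theorem cauchy_positionX {z : ℂ} (hz : z.im ≠ 0) (g : L2mu) :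
    cauchy hz (positionX g) = z * cauchy hz g - ⟪phiVec 0, g⟫_ℂ := by
  rw [cauchy_apply, cauchy_apply, inner_phiVec_zero, ← integral_const_mul,
    ← integral_sub ((integrable_inv_sub_mul hz g).const_mul z) (integrable_L2mu g)]
  refine integral_congr_ae ?_
  filter_upwards [positionX_coeFn g] with y hy
  have := ofReal_sub_ne_zero hz y
  rw [hy]
  field_simp
  ring

theorem cauchy_phiVec_one {z : ℂ} (hz : z.im ≠ 0) :
    cauchy hz (phiVec 1) = z * cauchy hz (phiVec 0) - 1 := by
  rw [← positionX_phiVec_zero, cauchy_positionX, orthonormal_iff_ite.1 orthonormal_phiVec]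
  simp

theorem cauchy_phiVec_add_two {z : ℂ} (hz : z.im ≠ 0) (n : ℕ) :
    cauchy hz (phiVec (n + 2)) = z * cauchy hz (phiVec (n + 1)) - cauchy hz (phiVec n) := by
  have h := cauchy_positionX hz (phiVec (n + 1))
  rw [positionX_phiVec_succ, map_add, orthonormal_iff_ite.1 orthonormal_phiVec] at h
  simp only [Nat.right_eq_add, Nat.add_eq_zero_iff, one_ne_zero, and_false,
    if_false, sub_zero] at h
  rw [← h]
  ring

/-- Up to conjugation these are the Fourier coefficients of one fixed vector, square summable by
Bessel's inequality. -/
theorem tendsto_cauchy_phiVec {z : ℂ} (hz : z.im ≠ 0) :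
    Tendsto (fun n => cauchy hz (phiVec n)) atTop (𝓝 0) := by
  rw [tendsto_zero_iff_norm_tendsto_zero]
  have h := (orthonormal_phiVec.inner_products_summable
    ((memLp_star_inv_sub hz).toLp _)).tendsto_atTop_zero
  have h2 := (Real.continuous_sqrt.tendsto 0).comp h
  rw [Real.sqrt_zero] at h2
  refine h2.congr fun n => ?_
  rw [Function.comp_apply, Real.sqrt_sq (norm_nonneg _), norm_inner_symm]
  rfl

/-- The quadratic equation of the Cauchy transform of the semi-circle law. -/
theorem cauchy_quadratic {z : ℂ} (hz : z.im ≠ 0) :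
    cauchy hz (phiVec 0) ^ 2 - z * cauchy hz (phiVec 0) + 1 = 0 := by
  set G : ℕ → ℂ := fun n => cauchy hz (phiVec n) with hG
  have h1 : G 1 = z * G 0 - 1 := cauchy_phiVec_one hz
  have h2 : ∀ n, G (n + 2) = z * G (n + 1) - G n := cauchy_phiVec_add_two hz
  -- A first integral of the recurrence. Its constant value is its limit, `0`, so no branch of `√(z²
  -- - 4)` need be chosen.
  have hinv : ∀ n, G (n + 1) ^ 2 - z * G (n + 1) * G n + G n ^ 2 = G 0 ^ 2 - z * G 0 + 1 := by
    intro n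
    induction n with
    | zero => rw [zero_add, h1]; ring
    | succ n ih => rw [← ih, h2]; ring
  have ht : Tendsto G atTop (𝓝 0) := tendsto_cauchy_phiVec hz
  have ht1 : Tendsto (fun n => G (n + 1)) atTop (𝓝 0) := ht.comp (tendsto_add_atTop_nat 1)
  have hlim := ((ht1.pow 2).sub ((ht1.const_mul z).mul ht)).add (ht.pow 2)
  simp_rw [hinv] at hlim
  simpa using tendsto_nhds_unique tendsto_const_nhds hlim

/-- By the quadratic equation the powers of `cauchy hz (phiVec 0)` satisfy the same two-step
recurrence. -/
theorem cauchy_phiVec {z : ℂ} (hz : z.im ≠ 0) (n : ℕ) :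
    cauchy hz (phiVec n) = cauchy hz (phiVec 0) ^ (n + 1) := by
  have hq := cauchy_quadratic hz
  have h1 : cauchy hz (phiVec 1) = cauchy hz (phiVec 0) ^ 2 := by
    rw [cauchy_phiVec_one]; linear_combination -hq
  induction n using Nat.strong_induction_on with
  | _ n ih =>
    match n with
    | 0 => rw [zero_add, pow_one]
    | 1 => exact h1
    | n + 2 =>
      rw [cauchy_phiVec_add_two, ih (n + 1) (by omega), ih n (by omega)]
      linear_combination -cauchy hz (phiVec 0) ^ (n + 1) * hq

/-- The Cauchy transform intertwines `a⁺ - a⁻` with a multiplication, up to a constant. -/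
theorem cauchy_creation_sub_annihilation {z : ℂ} (hz : z.im ≠ 0) (g : L2mu) :
    (z - 2 * cauchy hz (phiVec 0)) * cauchy hz g
      = ⟪phiVec 0, g⟫_ℂ - cauchy hz ((creation - annihilation) g) := by
  have hq := cauchy_quadratic hz
  -- On `phiVec n` the left side is `G^n - G^(n+2)`. For `n = 0` the term `G^0 = 1` is no Cauchy
  -- transform of a basis vector; the inner product with `phiVec 0` supplies it.
  have h : (z - 2 * cauchy hz (phiVec 0)) • cauchy hz
      = innerSL ℂ (phiVec 0) - cauchy hz ∘L (creation - annihilation) := by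
    refine ContinuousLinearMap.ext_on dense_span_phiVec ?_
    rintro _ ⟨n, rfl⟩
    simp only [smul_apply, sub_apply,
      ContinuousLinearMap.comp_apply, innerSL_apply_apply, creation_phiVec, smul_eq_mul,
      orthonormal_iff_ite.1 orthonormal_phiVec, map_sub]
    cases n with
    | zero =>
      rw [annihilation_phiVec_zero, map_zero, zero_add, cauchy_phiVec hz 1, if_pos rfl]
      linear_combination -hq
    | succ n =>
      rw [annihilation_phiVec_succ, cauchy_phiVec hz (n + 1), cauchy_phiVec hz (n + 1 + 1),
        cauchy_phiVec hz n, if_neg (by omega)]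
      linear_combination -cauchy hz (phiVec 0) ^ (n + 1) * hq
  have := congrArg (fun T : L2mu →L[ℂ] ℂ => T g) h
  simpa using this

/-! ### The adjoint of `V` -/

/-- Multiplying back by `ρ` gives `f` where `ρ ≠ 0` and `0` elsewhere. -/
theorem memLp_rhoInvMul (f : L2R) : MemLp (rhoInvMul f) 2 semicircle := by
  have hf : Measurable (f : ℝ → ℂ) := (Lp.stronglyMeasurable f).measurable
  have hm : Measurable (rhoInvMul f) := by
    have := measurable_rho
    unfold rhoInvMul
    fun_prop
  refine ⟨hm.aestronglyMeasurable, ?_⟩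
  rw [← eLpNorm_rho_mul _ hm]
  refine lt_of_le_of_lt (eLpNorm_mono fun x => ?_) (Lp.eLpNorm_lt_top f)
  unfold rhoInvMul
  by_cases h : rho x = 0
  · simp [h]
  · have : (rho x : ℂ) ≠ 0 := by exact_mod_cast h
    push_cast
    rw [mul_inv_cancel_left₀ this]

theorem integral_semicircle_complex (F : ℝ → ℂ) :
    ∫ y, F y ∂semicircle = ∫ y, (rho y : ℂ) ^ 2 * F y := by
  rw [semicircle_eq, integral_withDensity_eq_integral_toReal_smul
    (measurable_rho.pow_const 2).ennreal_ofReal (by simp)]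
  refine integral_congr_ae (Eventually.of_forall fun y => ?_)
  dsimp only
  rw [ENNReal.toReal_ofReal (by positivity), Complex.real_smul]
  push_cast
  rfl

theorem adjoint_V (f : L2R) :
    ContinuousLinearMap.adjoint V.toContinuousLinearMap f = (memLp_rhoInvMul f).toLp _ := by
  refine ext_inner_left ℂ fun h => ?_
  rw [ContinuousLinearMap.adjoint_inner_right, L2.inner_def, L2.inner_def,
    integral_semicircle_complex]
  refine integral_congr_ae ?_
  filter_upwards [V_coeFn h, ae_semicircle_iff.1 (MemLp.coeFn_toLp (memLp_rhoInvMul f))]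
    with x h1 h2
  change V h x = _ at h1
  change inner ℂ (V h x) (f x) = _
  rw [h1]
  by_cases h0 : rho x = 0
  · simp [h0]
  · have : (rho x : ℂ) ≠ 0 := by exact_mod_cast h0
    rw [h2 h0]
    simp only [RCLike.inner_apply, rhoInvMul, map_mul, Complex.conj_ofReal, Complex.ofReal_inv]
    field_simp

theorem conjV_coeFn (T : L2mu →L[ℂ] L2mu) (f : L2R) :
    conjV T f =ᵐ[volume] fun x => (rho x : ℂ) * T ((memLp_rhoInvMul f).toLp _) x := by
  have : conjV T f = V (T ((memLp_rhoInvMul f).toLp _)) := by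
    rw [← adjoint_V]
    rfl
  rw [this]
  exact V_coeFn _

/-- `V` is an isometry, so the inner factor `V* V` is the identity. -/
theorem conjV_comp (S T : L2mu →L[ℂ] L2mu) : conjV (S ∘L T) = conjV S ∘L conjV T := by
  have h : ContinuousLinearMap.adjoint V.toContinuousLinearMap ∘L V.toContinuousLinearMap
      = ContinuousLinearMap.id ℂ L2mu :=
    (ContinuousLinearMap.norm_map_iff_adjoint_comp_self V.toContinuousLinearMap).1 V.norm_map
  ext1 f
  have h' : ∀ g : L2mu, ContinuousLinearMap.adjoint V.toContinuousLinearMap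
      (V.toContinuousLinearMap g) = g := fun g => congrArg (fun T : L2mu →L[ℂ] L2mu => T g) h
  simp only [conjV, ContinuousLinearMap.comp_apply, h']

/-! ### Almost everywhere convergence of the principal value -/

/-- The density `ρ² g` of the measure `g μ`. -/
noncomputable def density (g : ℝ → ℂ) (x : ℝ) : ℂ := (rho x : ℂ) ^ 2 * g x

theorem measurable_density (g : L2mu) : Measurable (density g) := by
  have hm : Measurable (g : ℝ → ℂ) := (Lp.stronglyMeasurable g).measurable
  have := measurable_rho
  unfold density
  fun_prop

theorem integrable_density_of_integrable {g : ℝ → ℂ} (h : Integrable g semicircle) :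
    Integrable (density g) := by
  rw [semicircle_eq, integrable_withDensity_iff_integrable_smul'
    (measurable_rho.pow_const 2).ennreal_ofReal (by simp)] at h
  refine h.congr (Eventually.of_forall fun x => ?_)
  dsimp only
  rw [ENNReal.toReal_ofReal (by positivity), Complex.real_smul]
  push_cast
  rfl

theorem integrable_density (g : L2mu) : Integrable (density g) :=
  integrable_density_of_integrable (integrable_L2mu g)

theorem truncHilbert_eq (g : ℝ → ℂ) (x ε : ℝ) :
    truncHilbert g x ε = 2 * ∫ y, (truncKer ε (x - y) : ℂ) * density g y := by
  unfold truncHilbert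
  have hs : MeasurableSet {y : ℝ | ε < |x - y|} :=
    measurableSet_lt measurable_const (by fun_prop)
  rw [← integral_indicator hs, integral_semicircle_complex]
  congr 1
  refine integral_congr_ae (Eventually.of_forall fun y => ?_)
  dsimp only
  unfold truncKer density
  by_cases h : ε < |x - y|
  · rw [indicator_of_mem (by exact h), indicator_of_mem (by exact h), Complex.ofReal_inv]
    ring
  · rw [indicator_of_notMem (by exact h), indicator_of_notMem (by exact h)]
    simp

/-- Equality holds at every `x`, so the transform does not depend on representatives and can be
iterated. -/
theorem truncHilbert_congr {g h : ℝ → ℂ} (hgh : g =ᵐ[semicircle] h) :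
    truncHilbert g = truncHilbert h := by
  funext x ε
  unfold truncHilbert
  congr 1
  refine integral_congr_ae ?_
  filter_upwards [ae_restrict_of_ae hgh] with y hy
  rw [hy]

theorem hilbertMu_congr {g h : ℝ → ℂ} (hgh : g =ᵐ[semicircle] h) : hilbertMu g = hilbertMu h := by
  unfold hilbertMu
  rw [truncHilbert_congr hgh]

/-! ### Poisson integrals, the Cauchy transform at `x ± iε`, and boundary limits. -/

theorem integrable_poissonKer_mul (g : L2mu) {ε : ℝ} (hε : 0 < ε) (x : ℝ) :
    Integrable fun y => (poissonKer ε (x - y) : ℂ) * density g y := by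
  have := measurable_poissonKer ε
  refine (integrable_density g).bdd_mul (c := ε⁻¹)
    (Measurable.aestronglyMeasurable (by fun_prop)) (Eventually.of_forall fun y => ?_)
  rw [Complex.norm_real, Real.norm_of_nonneg (poissonKer_nonneg hε _)]
  exact poissonKer_le hε _

theorem integrable_conjPoissonKer_mul (g : L2mu) {ε : ℝ} (hε : 0 < ε) (x : ℝ) :
    Integrable fun y => (conjPoissonKer ε (x - y) : ℂ) * density g y := by
  have := measurable_conjPoissonKer ε
  refine (integrable_density g).bdd_mul (c := ε⁻¹)
    (Measurable.aestronglyMeasurable (by fun_prop)) (Eventually.of_forall fun y => ?_)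
  rw [Complex.norm_real]
  exact abs_conjPoissonKer_le hε _

theorem integrable_truncKer_sub_mul (g : L2mu) {ε : ℝ} (hε : 0 < ε) (x : ℝ) :
    Integrable fun y =>
      ((truncKer ε (x - y) - conjPoissonKer ε (x - y) : ℝ) : ℂ) * density g y := by
  have h1 := measurable_conjPoissonKer ε
  have h2 := measurable_truncKer ε
  refine (integrable_density g).bdd_mul (c := ε⁻¹)
    (Measurable.aestronglyMeasurable (by fun_prop)) (Eventually.of_forall fun y => ?_)
  rw [Complex.norm_real]
  exact (abs_truncKer_sub_conjPoissonKer_le hε _).trans (poissonKer_le hε _)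

/-- The Poisson integral of the measure `g μ`. -/
noncomputable def poissonInt (g : L2mu) (x ε : ℝ) : ℂ :=
  ∫ y, (poissonKer ε (x - y) : ℂ) * density g y

/-- The conjugate Poisson integral of the measure `g μ`. -/
noncomputable def conjPoissonInt (g : L2mu) (x ε : ℝ) : ℂ :=
  ∫ y, (conjPoissonKer ε (x - y) : ℂ) * density g y

theorem truncHilbert_eq_add (g : L2mu) (x : ℝ) {ε : ℝ} (hε : 0 < ε) :
    truncHilbert g x ε = 2 * (∫ y, ((truncKer ε (x - y) - conjPoissonKer ε (x - y) : ℝ) : ℂ)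
      * density g y) + 2 * conjPoissonInt g x ε := by
  rw [truncHilbert_eq, ← mul_add, conjPoissonInt,
    ← integral_add (integrable_truncKer_sub_mul g hε x) (integrable_conjPoissonKer_mul g hε x)]
  congr 1
  refine integral_congr_ae (Eventually.of_forall fun y => ?_)
  push_cast
  ring

theorem im_add_mul_I_ne_zero (x : ℝ) {ε : ℝ} (hε : 0 < ε) :
    ((x : ℂ) + ε * Complex.I).im ≠ 0 := by
  simpa using hε.ne'

theorem im_sub_mul_I_ne_zero (x : ℝ) {ε : ℝ} (hε : 0 < ε) :
    ((x : ℂ) - ε * Complex.I).im ≠ 0 := by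
  simpa using hε.ne'

theorem cauchy_add_mul_I (g : L2mu) (x : ℝ) {ε : ℝ} (hε : 0 < ε) :
    cauchy (im_add_mul_I_ne_zero x hε) g
      = conjPoissonInt g x ε - Complex.I * poissonInt g x ε := by
  rw [cauchy_apply, integral_semicircle_complex, conjPoissonInt, poissonInt, ← integral_const_mul,
    ← integral_sub (integrable_conjPoissonKer_mul g hε x)
      ((integrable_poissonKer_mul g hε x).const_mul _)]
  refine integral_congr_ae (Eventually.of_forall fun y => ?_)
  have h1 := ofReal_sub_ne_zero (im_add_mul_I_ne_zero x hε) y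
  have h2 : ((x : ℂ) - y) ^ 2 + ε ^ 2 ≠ 0 := by
    norm_cast
    positivity
  dsimp only [density, poissonKer, conjPoissonKer]
  push_cast
  field_simp
  linear_combination (rho y : ℂ) ^ 2 * g y * (ε : ℂ) ^ 2 * Complex.I_sq

theorem cauchy_sub_mul_I (g : L2mu) (x : ℝ) {ε : ℝ} (hε : 0 < ε) :
    cauchy (im_sub_mul_I_ne_zero x hε) g
      = conjPoissonInt g x ε + Complex.I * poissonInt g x ε := by
  rw [cauchy_apply, integral_semicircle_complex, conjPoissonInt, poissonInt, ← integral_const_mul,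
    ← integral_add (integrable_conjPoissonKer_mul g hε x)
      ((integrable_poissonKer_mul g hε x).const_mul _)]
  refine integral_congr_ae (Eventually.of_forall fun y => ?_)
  have h1 := ofReal_sub_ne_zero (im_sub_mul_I_ne_zero x hε) y
  have h2 : ((x : ℂ) - y) ^ 2 + ε ^ 2 ≠ 0 := by
    norm_cast
    positivity
  dsimp only [density, poissonKer, conjPoissonKer]
  push_cast
  field_simp
  linear_combination (rho y : ℂ) ^ 2 * g y * (ε : ℂ) ^ 2 * Complex.I_sq

/-- The difference of the quadratic equations at `x + iε` and `x - iε`. It gives `x - 2 Q_0 = xε /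
(ε + 2 P_0)` when the denominator is nonzero. -/
theorem conjPoissonInt_phiVec_zero_mul (x : ℝ) {ε : ℝ} (hε : 0 < ε) :
    conjPoissonInt (phiVec 0) x ε * (ε + 2 * poissonInt (phiVec 0) x ε)
      = x * poissonInt (phiVec 0) x ε := by
  have h1 := cauchy_quadratic (im_add_mul_I_ne_zero x hε)
  have h2 := cauchy_quadratic (im_sub_mul_I_ne_zero x hε)
  rw [cauchy_add_mul_I _ x hε] at h1
  rw [cauchy_sub_mul_I _ x hε] at h2
  have : Complex.I * (conjPoissonInt (phiVec 0) x ε * (ε + 2 * poissonInt (phiVec 0) x ε)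
      - x * poissonInt (phiVec 0) x ε) = 0 := by
    linear_combination (h2 - h1) / 2
  have := (mul_eq_zero.1 this).resolve_left Complex.I_ne_zero
  exact sub_eq_zero.1 this

/-- Subtracting the intertwining identities at `x ± iε` cancels the constant `⟪phiVec 0, g⟫`. Using
both points replaces real and imaginary parts, as `g` is complex valued. -/
theorem mul_conjPoissonInt (g : L2mu) (x : ℝ) {ε : ℝ} (hε : 0 < ε) :
    (ε + 2 * poissonInt (phiVec 0) x ε) * conjPoissonInt g x ε
      = poissonInt ((creation - annihilation) g) x ε
        + (x - 2 * conjPoissonInt (phiVec 0) x ε) * poissonInt g x ε := by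
  have h1 := cauchy_creation_sub_annihilation (im_add_mul_I_ne_zero x hε) g
  have h2 := cauchy_creation_sub_annihilation (im_sub_mul_I_ne_zero x hε) g
  rw [cauchy_add_mul_I _ x hε, cauchy_add_mul_I _ x hε, cauchy_add_mul_I _ x hε] at h1
  rw [cauchy_sub_mul_I _ x hε, cauchy_sub_mul_I _ x hε, cauchy_sub_mul_I _ x hε] at h2
  refine mul_left_cancel₀ Complex.I_ne_zero ?_
  linear_combination (h1 - h2) / 2

theorem ae_tendsto_poissonInt (g : L2mu) :
    ∀ᵐ x, Tendsto (poissonInt g x) (𝓝[>] 0) (𝓝 (Real.pi * density g x)) := by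
  filter_upwards [ae_tendsto_lintegral_poissonKer_mul_sub (measurable_density g)
    (integrable_density g)] with x hx
  exact tendsto_integral_kernel (integrable_density g) hx measurable_poissonKer
    (fun ε hε t => (abs_of_nonneg (poissonKer_nonneg hε t)).le) fun ε hε => integral_poissonKer hε

/-- The kernel of the difference is dominated by the Poisson kernel and has integral `0`, so its
limit at a Lebesgue point is `0` times the density. -/
theorem ae_tendsto_truncHilbert_sub (g : L2mu) :
    ∀ᵐ x, Tendsto (fun ε => truncHilbert g x ε - 2 * conjPoissonInt g x ε) (𝓝[>] 0) (𝓝 0) := by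
  filter_upwards [ae_tendsto_lintegral_poissonKer_mul_sub (measurable_density g)
    (integrable_density g)] with x hx
  have h := (tendsto_integral_kernel (integrable_density g) hx
    (k := fun ε t => truncKer ε t - conjPoissonKer ε t)
    (fun ε => (measurable_truncKer ε).sub (measurable_conjPoissonKer ε))
    (fun ε hε t => abs_truncKer_sub_conjPoissonKer_le hε t)
    fun ε _ => integral_truncKer_sub_conjPoissonKer ε).const_mul 2
  rw [Complex.ofReal_zero, zero_mul, mul_zero] at h
  refine h.congr' ?_
  filter_upwards [self_mem_nhdsWithin] with ε hε
  rw [truncHilbert_eq_add g x hε, add_sub_cancel_right]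

/-- The principal value exists almost everywhere and equals `(a⁺ - a⁻) g`. -/
theorem ae_hasHilbertAt (g : L2mu) :
    ∀ᵐ x ∂semicircle, HasHilbertAt g x ((creation - annihilation) g x) := by
  rw [ae_semicircle_iff]
  filter_upwards [ae_tendsto_poissonInt g, ae_tendsto_poissonInt ((creation - annihilation) g),
    ae_tendsto_poissonInt (phiVec 0), ae_tendsto_truncHilbert_sub g,
    ae_semicircle_iff.1 (MemLp.coeFn_toLp (memLp_phi 0))] with x hg hK h0 hT h1 hx
  have h1 : phiVec 0 x = 1 := by
    refine (h1 hx).trans ?_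
    simp [phiPoly]
  have hρ : (rho x : ℂ) ≠ 0 := by exact_mod_cast hx
  have hπ : (Real.pi : ℂ) ≠ 0 := by exact_mod_cast Real.pi_ne_zero
  have hε : Tendsto (fun ε : ℝ => (ε : ℂ)) (𝓝[>] 0) (𝓝 0) := by
    have := (Complex.continuous_ofReal.tendsto 0).mono_left
      (nhdsWithin_le_nhds (s := Ioi (0 : ℝ)))
    simpa using this
  have hB := hε.add (h0.const_mul 2)
  -- The limit of `ε + 2 P_0` is `2πρ(x)²`; this is where `ρ(x) ≠ 0` enters.
  have hB0 : (0 : ℂ) + 2 * (Real.pi * density (phiVec 0) x) ≠ 0 := by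
    unfold density
    rw [h1]
    simp [hρ, hπ]
  have hA : Tendsto (fun ε => (x : ℂ) - 2 * conjPoissonInt (phiVec 0) x ε) (𝓝[>] 0) (𝓝 0) := by
    have := (hε.const_mul (x : ℂ)).div hB hB0
    rw [mul_zero, zero_div] at this
    refine this.congr' ?_
    filter_upwards [self_mem_nhdsWithin, hB.eventually_ne hB0] with ε hε0 hne
    have := conjPoissonInt_phiVec_zero_mul x hε0
    rw [Pi.div_apply, div_eq_iff hne]
    linear_combination 2 * this
  -- The limit is the quotient of `πρ² (a⁺ - a⁻)g` by `2πρ²`.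
  have hQ : Tendsto (conjPoissonInt g x) (𝓝[>] 0)
      (𝓝 ((creation - annihilation) g x / 2)) := by
    have := (hK.add (hA.mul hg)).div hB hB0
    have hlim : (Real.pi * density ((creation - annihilation) g) x
        + 0 * (Real.pi * density g x)) / (0 + 2 * (Real.pi * density (phiVec 0) x))
        = (creation - annihilation) g x / 2 := by
      unfold density
      rw [h1]
      field_simp
      ring
    rw [hlim] at this
    refine this.congr' ?_
    filter_upwards [self_mem_nhdsWithin, hB.eventually_ne hB0] with ε hε0 hne
    rw [Pi.div_apply, div_eq_iff hne, ← mul_conjPoissonInt g x hε0, mul_comm]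
  have := hT.add (hQ.const_mul 2)
  unfold HasHilbertAt
  rw [zero_add, mul_div_cancel₀ _ (two_ne_zero : (2 : ℂ) ≠ 0)] at this
  exact this.congr fun ε => by ring

theorem hilbertMu_ae_eq (g : L2mu) :
    hilbertMu g =ᵐ[semicircle] (creation - annihilation) g := by
  filter_upwards [ae_hasHilbertAt g] with x hx
  exact hx.limUnder_eq

theorem hilbertMu_ae_eq_toLp {g : ℝ → ℂ} (hg : MemLp g 2 semicircle) :
    hilbertMu g =ᵐ[semicircle] (creation - annihilation) (hg.toLp g) := by
  rw [← hilbertMu_congr (MemLp.coeFn_toLp hg)]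
  exact hilbertMu_ae_eq _

theorem memLp_hilbertMu {g : ℝ → ℂ} (hg : MemLp g 2 semicircle) :
    MemLp (hilbertMu g) 2 semicircle :=
  (memLp_congr_ae (hilbertMu_ae_eq_toLp hg)).2 (Lp.memLp _)

theorem ae_hasHilbertAt_hilbertMu {g : ℝ → ℂ} (hg : MemLp g 2 semicircle) :
    ∀ᵐ x ∂semicircle, HasHilbertAt g x (hilbertMu g x) := by
  filter_upwards [ae_hasHilbertAt (hg.toLp g), hilbertMu_ae_eq_toLp hg] with x h1 h2
  rw [h2]
  unfold HasHilbertAt at h1 ⊢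
  rwa [truncHilbert_congr (MemLp.coeFn_toLp hg)] at h1

/-! ### The operators on `L²(ℝ)` -/

/-- The factor `ρ` kills both sides off its support, so equality `μ`-almost everywhere suffices. -/
theorem conjV_coeFn_of_ae {T : L2mu →L[ℂ] L2mu} {f : L2R} {F : ℝ → ℂ}
    (h : T ((memLp_rhoInvMul f).toLp _) =ᵐ[semicircle] F) :
    conjV T f =ᵐ[volume] fun x => (rho x : ℂ) * F x := by
  filter_upwards [conjV_coeFn T f, ae_semicircle_iff.1 h] with x h1 h2
  rw [h1]
  by_cases h0 : rho x = 0
  · simp [h0]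
  · rw [h2 h0]

theorem rho_eq_zero_iff (x : ℝ) : rho x = 0 ↔ x ∉ Ioo (-2 : ℝ) 2 := by
  constructor
  · intro h hx
    have h0 : 0 < 4 - x ^ 2 := by nlinarith [hx.1, hx.2]
    have := Real.pi_pos
    rw [rho, indicator_of_mem (Ioo_subset_Icc_self hx)] at h
    have : 0 < (4 - x ^ 2) ^ (1 / 4 : ℝ) / Real.sqrt (2 * Real.pi) := by positivity
    exact this.ne' h
  · intro hx
    rw [rho]
    by_cases h : x ∈ Icc (-2 : ℝ) 2
    · rw [indicator_of_mem h]
      have : 4 - x ^ 2 = 0 := by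
        rcases eq_or_lt_of_le h.1 with h1 | h1
        · rw [← h1]; norm_num
        · rcases eq_or_lt_of_le h.2 with h2 | h2
          · rw [h2]; norm_num
          · exact absurd ⟨h1, h2⟩ hx
      rw [this, Real.zero_rpow (by norm_num), zero_div]
    · exact indicator_of_notMem h _

/-- Since `ρ` also vanishes at `±2`, the pointwise identity has the open interval; the endpoints are
a null set. -/
theorem rho_mul_mul_rhoInvMul_ae (f : ℝ → ℂ) :
    (fun x : ℝ => (rho x : ℂ) * (x * rhoInvMul f x)) =ᵐ[volume]
      (Icc (-2 : ℝ) 2).indicator fun x => (x : ℂ) * f x := by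
  refine EventuallyEq.trans (Eventually.of_forall fun x => ?_)
    (indicator_ae_eq_of_ae_eq_set (Ioo_ae_eq_Icc (μ := volume) (a := (-2 : ℝ)) (b := 2)))
  dsimp only
  by_cases h : rho x = 0
  · rw [indicator_of_notMem ((rho_eq_zero_iff x).1 h)]
    simp [h]
  · have hm : x ∈ Ioo (-2 : ℝ) 2 := not_not.1 (mt (rho_eq_zero_iff x).2 h)
    have : (rho x : ℂ) ≠ 0 := by exact_mod_cast h
    rw [indicator_of_mem hm, rhoInvMul]
    push_cast
    field_simp

theorem positionX_rhoInvMul (f : L2R) :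
    positionX ((memLp_rhoInvMul f).toLp _) =ᵐ[semicircle] fun x => (x : ℂ) * rhoInvMul f x := by
  filter_upwards [positionX_coeFn ((memLp_rhoInvMul f).toLp _),
    MemLp.coeFn_toLp (memLp_rhoInvMul f)] with x h1 h2
  rw [h1, h2]

theorem conjV_smul (c : ℂ) (T : L2mu →L[ℂ] L2mu) : conjV (c • T) = c • conjV T := by
  ext1 f
  simp [conjV]

theorem conjV_position_coeFn (f : L2R) : conjV positionX f =ᵐ[volume]
    (Icc (-2 : ℝ) 2).indicator fun x => (x : ℂ) * f x :=
  (conjV_coeFn_of_ae (positionX_rhoInvMul f)).trans (rho_mul_mul_rhoInvMul_ae f)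

theorem momentumX_ae_eq {g : ℝ → ℂ} (hg : MemLp g 2 semicircle) :
    momentumX (hg.toLp g) =ᵐ[semicircle] fun x => Complex.I * hilbertMu g x := by
  filter_upwards [hilbertMu_ae_eq_toLp hg,
    Lp.coeFn_smul Complex.I ((creation - annihilation) (hg.toLp g))] with x h1 h2
  change (Complex.I • ((creation - annihilation) (hg.toLp g))) x = _
  rw [h2, Pi.smul_apply, h1, smul_eq_mul]

theorem conjV_momentum_coeFn (f : L2R) : conjV momentumX f =ᵐ[volume]
    fun x => Complex.I * (rho x * hilbertMu (rhoInvMul f) x) := by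
  filter_upwards [conjV_coeFn_of_ae (momentumX_ae_eq (memLp_rhoInvMul f))] with x hx
  rw [hx]
  ring

theorem creation_eq : creation = (1 / 2 : ℂ) • (positionX + (creation - annihilation)) := by
  rw [positionX_eq]
  module

theorem annihilation_eq :
    annihilation = (1 / 2 : ℂ) • (positionX - (creation - annihilation)) := by
  rw [positionX_eq]
  module

theorem conjV_creation_coeFn (f : L2R) : conjV creation f =ᵐ[volume]
    fun x => (1 / 2 : ℂ) * ((Icc (-2 : ℝ) 2).indicator (fun x => (x : ℂ) * f x) x
      + rho x * hilbertMu (rhoInvMul f) x) := by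
  set u := (memLp_rhoInvMul f).toLp _ with hu
  have h : creation u =ᵐ[semicircle]
      fun x => (1 / 2 : ℂ) * (x * rhoInvMul f x + hilbertMu (rhoInvMul f) x) := by
    have he : creation u = (1 / 2 : ℂ) • (positionX u + (creation - annihilation) u) :=
      congrArg (fun T : L2mu →L[ℂ] L2mu => T u) creation_eq
    rw [he]
    filter_upwards [Lp.coeFn_smul (1 / 2 : ℂ) (positionX u + (creation - annihilation) u),
      Lp.coeFn_add (positionX u) ((creation - annihilation) u), positionX_rhoInvMul f,
      hilbertMu_ae_eq_toLp (memLp_rhoInvMul f)] with x h1 h2 h3 h4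
    rw [h1, Pi.smul_apply, h2, Pi.add_apply, hu, h3, h4, smul_eq_mul]
  filter_upwards [conjV_coeFn_of_ae h, rho_mul_mul_rhoInvMul_ae f] with x h1 h2
  rw [h1, ← h2]
  ring

theorem conjV_annihilation_coeFn (f : L2R) : conjV annihilation f =ᵐ[volume]
    fun x => (1 / 2 : ℂ) * ((Icc (-2 : ℝ) 2).indicator (fun x => (x : ℂ) * f x) x
      - rho x * hilbertMu (rhoInvMul f) x) := by
  set u := (memLp_rhoInvMul f).toLp _ with hu
  have h : annihilation u =ᵐ[semicircle]
      fun x => (1 / 2 : ℂ) * (x * rhoInvMul f x - hilbertMu (rhoInvMul f) x) := by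
    have he : annihilation u = (1 / 2 : ℂ) • (positionX u - (creation - annihilation) u) :=
      congrArg (fun T : L2mu →L[ℂ] L2mu => T u) annihilation_eq
    rw [he]
    filter_upwards [Lp.coeFn_smul (1 / 2 : ℂ) (positionX u - (creation - annihilation) u),
      Lp.coeFn_sub (positionX u) ((creation - annihilation) u), positionX_rhoInvMul f,
      hilbertMu_ae_eq_toLp (memLp_rhoInvMul f)] with x h1 h2 h3 h4
    rw [h1, Pi.smul_apply, h2, Pi.sub_apply, hu, h3, h4, smul_eq_mul]
  filter_upwards [conjV_coeFn_of_ae h, rho_mul_mul_rhoInvMul_ae f] with x h1 h2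
  rw [h1, ← h2]
  ring

theorem conjV_preservation : conjV preservation = 0 := by
  have : preservation = 0 := by
    rw [preservation, positionX_eq]
    abel
  rw [this]
  ext1 f
  simp [conjV]

theorem conjV_kinetic :
    conjV kineticX = (1 / 2 : ℂ) • (conjV momentumX ∘L conjV momentumX) := by
  rw [kineticX, conjV_smul, conjV_comp]

theorem conjV_kinetic_coeFn (f : L2R) : conjV kineticX f =ᵐ[volume]
    fun x => -(1 / 2 : ℂ) * (rho x * hilbertMu (hilbertMu (rhoInvMul f)) x) := by
  have hg := memLp_rhoInvMul f
  have hH := memLp_hilbertMu hg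
  -- `H_μ (ρ⁻¹ f)` is repackaged as a vector of `L²(μ)`, so that the momentum formula applies a
  -- second time.
  have h1 : momentumX (hg.toLp _) = Complex.I • hH.toLp _ := by
    rw [← MemLp.toLp_const_smul]
    refine Lp.ext ((momentumX_ae_eq hg).trans ?_)
    exact (MemLp.coeFn_toLp (hH.const_smul Complex.I)).symm
  have h : kineticX (hg.toLp _) =ᵐ[semicircle]
      fun x => -(1 / 2 : ℂ) * hilbertMu (hilbertMu (rhoInvMul f)) x := by
    have he : kineticX (hg.toLp _) = (Complex.I / 2) • momentumX (hH.toLp _) := by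
      change (1 / 2 : ℂ) • momentumX (momentumX (hg.toLp _)) = _
      rw [h1, map_smul, smul_smul]
      ring_nf
    rw [he]
    filter_upwards [Lp.coeFn_smul (Complex.I / 2) (momentumX (hH.toLp _)),
      momentumX_ae_eq hH] with x e1 e2
    rw [e1, Pi.smul_apply, e2, smul_eq_mul]
    linear_combination hilbertMu (hilbertMu (rhoInvMul f)) x / 2 * Complex.I_sq
  filter_upwards [conjV_coeFn_of_ae h] with x hx
  rw [hx]
  ring

end FreeQM

theorem theorem2p2 :
    -- `H_μ` is a well-defined operator on `L²(μ)`: the principal value exists almost everywhere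
    -- and defines an element of `L²(μ)`; moreover `ρ⁻¹` maps `L²(ℝ)` into `L²(μ)`
    (∀ g : ℝ → ℂ, MemLp g 2 semicircle →
      (∀ᵐ x ∂semicircle, HasHilbertAt g x (hilbertMu g x)) ∧ MemLp (hilbertMu g) 2 semicircle) ∧
    (∀ f : L2R, MemLp (rhoInvMul f) 2 semicircle) ∧
    -- position
    (∀ f : L2R, conjV positionX f =ᵐ[volume]
      (Icc (-2 : ℝ) 2).indicator fun x => (x : ℂ) * f x) ∧
    -- momentum
    (∀ f : L2R, conjV momentumX f =ᵐ[volume]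
      fun x => Complex.I * (rho x * hilbertMu (rhoInvMul f) x)) ∧
    -- creation, annihilation and preservation operators
    (∀ f : L2R, conjV creation f =ᵐ[volume]
      fun x => (1 / 2 : ℂ) * ((Icc (-2 : ℝ) 2).indicator (fun x => (x : ℂ) * f x) x
        + rho x * hilbertMu (rhoInvMul f) x)) ∧
    (∀ f : L2R, conjV annihilation f =ᵐ[volume]
      fun x => (1 / 2 : ℂ) * ((Icc (-2 : ℝ) 2).indicator (fun x => (x : ℂ) * f x) x
        - rho x * hilbertMu (rhoInvMul f) x)) ∧
    conjV preservation = 0 ∧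
    -- kinetic energy
    conjV kineticX = (1 / 2 : ℂ) • (conjV momentumX ∘L conjV momentumX) ∧
    (∀ f : L2R, conjV kineticX f =ᵐ[volume]
      fun x => -(1 / 2 : ℂ) * (rho x * hilbertMu (hilbertMu (rhoInvMul f)) x)) :=
  ⟨fun _ hg => ⟨ae_hasHilbertAt_hilbertMu hg, memLp_hilbertMu hg⟩, memLp_rhoInvMul,
    conjV_position_coeFn, conjV_momentum_coeFn, conjV_creation_coeFn, conjV_annihilation_coeFn,
    conjV_preservation, conjV_kinetic, conjV_kinetic_coeFn⟩
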